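/- Let $\mathbb T$ be the unit circle with normalized Lebesgue measure $d\mathbf m$, and let $\mathbb H^2_+(\mathbb T)\subset L^2(\mathbb T)$ be the Hardy space of functions whose Fourier coefficients with negative index vanish. A bounded operator $\mathbf G$ on $\mathbb H^2_+(\mathbb T)$ is called the Hankel operator with symbol $\sigma\in L^\infty(\mathbb T)$ if $$(\mathbf G u,u)=\int_{\mathbb T}\sigma(\mu)\,u(\bar\mu)\,\overline{u(\mu)}\,d\mathbf m(\mu)\qquad\text{for all }u\in\mathbb H^2_+(\mathbb T).$$ Let $$\omega(\zeta)=R_1(\zeta)+\sum_{m=2}^{M}R_m(\zeta)\,(\zeta-\gamma_m)^{-K_m-1},$$ where $M\ge 1$, $\gamma_2,\dots,\gamma_M\in\mathbb C$ are pairwise distinct, $|\gamma_m|>1$, $K_m\in\mathbb Z_+$, $R_1,\dots,R_M$ are complex polynomials, and $\deg R_m\le K_m$, $R_m(\gamma_m)\ne 0$ for $m\ge 2$. If $R_1\neq0$, put $K_1=\deg R_1$. Let $\mathbf G$ be the Hankel operator on $\mathbb H^2_+(\mathbb T)$ with symbol $\pi i\,\mu^{-1}\operatorname{sgn}\operatorname{Im}\mu+\omega(\mu)$,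 and suppose that $\mathbf G$ is self-adjoint. Put $\mathsf p_1=R_1^{(K_1)}$ if $R_1\ne0$, and $\mathsf p_m=-R_m(\gamma_m)\operatorname{sgn}\gamma_m$ for those $m\ge2$ with $\gamma_m$ real (these numbers are real and non-zero because $\mathbf G$ is self-adjoint). For these $m$ let $$\mathcal N_-^{(m)}=\begin{cases}(K_m+1)/2,& K_m\text{ odd},\\ K_m/2,& K_m\text{ even and }\mathsf p_m>0,\\ K_m/2+1,& K_m\text{ even and }\mathsf p_m<0,\end{cases}$$ and put $\mathcal N_-^{(1)}=0$ if $R_1=0$. Then the part of the spectrum of $\mathbf G$ in $(-\infty,0)$ consists of eigenvalues, and the total number $N_-(\mathbf G)$ of strictly negative eigenvalues, counted with multiplicity, is finite and equals $$N_-(\mathbf G)=\mathcal N_-^{(1)}+\sum_{m\ge2,\ \operatorname{Im}\gamma_m=0}\mathcal N_-^{(m)}+\sum_{m\ge2,\ \operatorname{Im}\gamma_m<0}K_m+M_1,$$ where $M_1$ is the number of indices $m\ge2$ with $\operatorname{Im}\gamma_m<0$. -/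

import Mathlib

/-!
On polynomials `u` the form `(G u, u)` is `∫ |u|²` over `[-1, 1]`, contributed by the Carleman
symbol, plus a sum of jet functionals applied to `u(z) conj(u(z̄))`: the pole at `γₘ` gives a jet
of order `Kₘ` at `γₘ⁻¹`, and `R₁` a jet of order `deg R₁` at `0`. Self-adjointness makes the nodes
symmetric about the real axis, with equal orders at conjugate nodes.

Let `N` be the claimed number. The sum of jets is nonnegative on the polynomials that vanish to
suitable orders, `N` in all, at the nodes; the whole form is then nonnegative there too. With the
complementary orders it is nonpositive, on a space of dimension `N` modulo the common kernel of
the jets; as the sum of jets is nondegenerate modulo that kernel, it is negative definite on some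
space of dimension at least `N`. Multiplication by a polynomial `e` that is close to `0` in
`L²(-1, 1)` but has the jet of `1` at every node leaves the jets alone and makes `∫ |u|²`
negligible, so the whole form is negative definite on such a space. By Glazman's lemma the
negative spectrum of `G` consists of exactly `N` eigenvalues.
-/

open MeasureTheory

/-- The Hardy space `H²₊(𝕋)`: the functions of `L²(𝕋)`, with respect to the normalized Lebesgue
measure, whose Fourier coefficients with negative index vanish. The unit circle is parametrized
by `t ↦ μ = exp (2 π i t) = AddCircle.toCircle t`, so that complex conjugation `μ ↦ μ̄` is
`t ↦ -t`. -/
def hardySpace :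
    Submodule ℂ (Lp ℂ 2 (AddCircle.haarAddCircle : Measure UnitAddCircle)) where
  carrier := {u | ∀ n : ℤ, n < 0 → fourierCoeff (u : UnitAddCircle → ℂ) n = 0}
  zero_mem' n _ := by
    rw [← fourierBasis_repr]; simp
  add_mem' {u v} hu hv n hn := by
    have h1 := hu n hn
    have h2 := hv n hn
    rw [← fourierBasis_repr] at h1 h2 ⊢
    simp [h1, h2]
  smul_mem' c u hu n hn := by
    have h1 := hu n hn
    rw [← fourierBasis_repr] at h1 ⊢
    simp [h1]

theorem isClosed_hardySpace :
    IsClosed (hardySpace : Set (Lp ℂ 2 (AddCircle.haarAddCircle : Measure UnitAddCircle))) := by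
  have h : (hardySpace : Set (Lp ℂ 2 (AddCircle.haarAddCircle : Measure UnitAddCircle))) =
      ⋂ n : ℤ, ⋂ _ : n < 0, {u | inner ℂ (fourierBasis n) u = 0} := by
    ext u
    simp only [SetLike.mem_coe, Set.mem_iInter, Set.mem_ofPred_eq, ← HilbertBasis.repr_apply_apply,
      fourierBasis_repr]
    rfl
  rw [h]
  exact isClosed_iInter fun n => isClosed_iInter fun _ =>
    isClosed_eq (by fun_prop) continuous_const

instance instCompleteSpaceHardySpace : CompleteSpace hardySpace :=
  isClosed_hardySpace.completeSpace_coe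

/-- `G` is the Hankel operator on `H²₊(𝕋)` with (essentially bounded) symbol `ω`:
`(G u, u) = ∫_𝕋 ω(μ) u(μ̄) conj(u(μ)) dm(μ)` for all `u`. Mathlib's inner product is linear in
its second argument. -/
structure IsHankelOperator (G : hardySpace →L[ℂ] hardySpace) (ω : Circle → ℂ) : Prop where
  memLp_symbol :
    MemLp (fun t : UnitAddCircle => ω (AddCircle.toCircle t)) ⊤ AddCircle.haarAddCircle
  inner_eq : ∀ u : hardySpace,
    inner ℂ u (G u) =
      ∫ t : UnitAddCircle,
        ω (AddCircle.toCircle t) * (u : Lp ℂ 2 AddCircle.haarAddCircle) (-t) *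
          (starRingEnd ℂ) ((u : Lp ℂ 2 AddCircle.haarAddCircle) t)
        ∂AddCircle.haarAddCircle

/-- The symbol `π i μ⁻¹ sgn (Im μ)` of the Carleman operator. -/
noncomputable def carlemanSymbol (μ : Circle) : ℂ :=
  (Real.pi : ℂ) * Complex.I * (μ : ℂ)⁻¹ * (Real.sign (μ : ℂ).im : ℂ)

/-- The rational function `R₁(ζ) + ∑ₘ Rₘ(ζ) (ζ - γₘ) ^ (-Kₘ - 1)`. -/
noncomputable def rationalSymbol (R₁ : Polynomial ℂ) {n : ℕ} (γ : Fin n → ℂ) (K : Fin n → ℕ)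
    (R : Fin n → Polynomial ℂ) (ζ : ℂ) : ℂ :=
  R₁.eval ζ + ∑ m, (R m).eval ζ / (ζ - γ m) ^ (K m + 1)

/-- The number `𝒩₋` of negative eigenvalues attached to a real term of degree `K` with
(nonzero) top coefficient `p`. -/
noncomputable def negCount (K : ℕ) (p : ℝ) : ℕ :=
  if Odd K then (K + 1) / 2 else if 0 < p then K / 2 else K / 2 + 1

/-- The span of all eigenvectors of `G` with a strictly negative eigenvalue. For self-adjoint `G`
it is the orthogonal sum of the corresponding eigenspaces, so its dimension is the
total number of negative eigenvalues, counted with multiplicity. -/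
noncomputable def negEigenspace {H : Type*} [NormedAddCommGroup H] [InnerProductSpace ℂ H]
    (G : H →L[ℂ] H) : Submodule ℂ H :=
  ⨆ t : ℝ, ⨆ _ : t < 0, Module.End.eigenspace (G : H →ₗ[ℂ] H) (t : ℂ)

section NegativeSpectrum

theorem isCompactOperator_starProjection {𝕜 E : Type*} [RCLike 𝕜] [NormedAddCommGroup E]
    [InnerProductSpace 𝕜 E] (U : Submodule 𝕜 E) [FiniteDimensional 𝕜 U] :
    IsCompactOperator U.starProjection :=
  (isCompactOperator_of_locallyCompactSpace_dom U.orthogonalProjectionOnto).clm_comp U.subtypeL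

theorem isUnit_add_of_isCompactOperator {E : Type*} [NormedAddCommGroup E] [NormedSpace ℂ E]
    [CompleteSpace E] {B F : E →L[ℂ] E} (hB : IsUnit B) (hF : IsCompactOperator F)
    (hinj : ∀ v, (B + F) v = 0 → v = 0) : IsUnit (B + F) := by
  obtain ⟨b, rfl⟩ := hB
  have hfactor : (b + F : E →L[ℂ] E) = -(b * (algebraMap ℂ _ (-1) - ↑b⁻¹ * F)) := by
    simp [mul_sub, add_comm]
  rw [hfactor]
  refine (b.isUnit.mul ?_).neg
  have hcompact : IsCompactOperator (↑b⁻¹ * F : E →L[ℂ] E) := hF.clm_comp (↑b⁻¹ : E →L[ℂ] E)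
  rcases hcompact.hasEigenvalue_or_mem_resolventSet (μ := (-1 : ℂ)) (by norm_num) with h | h
  · obtain ⟨v, hv, hv0⟩ := h.exists_hasEigenvector
    have hv' : (↑b⁻¹ * F : E →L[ℂ] E) v = -v := by
      simpa using Module.End.mem_eigenspace_iff.1 hv
    refine absurd (hinj v ?_) hv0
    rw [hfactor]
    simp only [neg_apply, mul_apply_eq_comp, sub_apply, hv']
    simp
  · exact spectrum.mem_resolventSet_iff.1 h

variable {H : Type*} [NormedAddCommGroup H] [InnerProductSpace ℂ H]

theorem isUnit_compression_sub_smul [CompleteSpace H] {G : H →L[ℂ] H} {U : Submodule ℂ H}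
    [U.HasOrthogonalProjection] (hU : ∀ u ∈ U, 0 ≤ (inner ℂ u (G u)).re) {t : ℝ} (ht : t < 0) :
    IsUnit (U.starProjection ∘L G ∘L U.starProjection - (t : ℂ) • 1) := by
  set Q := U.starProjection
  refine ContinuousLinearMap.isUnit_of_forall_le_norm_inner_map _ (c := Real.toNNReal (-t))
    (by simpa using ht) fun x => ?_
  have hform : inner ℂ ((Q ∘L G ∘L Q - (t : ℂ) • 1) x) x =
      inner ℂ (G (Q x)) (Q x) - (t : ℂ) * inner ℂ x x := by
    simp only [sub_apply, ContinuousLinearMap.comp_apply, smul_apply, one_apply_eq_self,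
      inner_sub_left, inner_smul_left, Complex.conj_ofReal]
    rw [Submodule.inner_starProjection_left_eq_right]
  have hnonneg : 0 ≤ (inner ℂ (G (Q x)) (Q x)).re :=
    (hU (Q x) (U.starProjection_apply_mem x)).trans_eq (inner_re_symm (𝕜 := ℂ) _ _)
  have hnorm : (inner ℂ x x).re = ‖x‖ ^ 2 := inner_self_eq_norm_sq (𝕜 := ℂ) x
  calc ‖x‖ ^ 2 * (Real.toNNReal (-t) : ℝ)
      ≤ (inner ℂ (G (Q x)) (Q x)).re - t * ‖x‖ ^ 2 := by
        rw [Real.coe_toNNReal _ (by linarith)]; linarith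
    _ = (inner ℂ ((Q ∘L G ∘L Q - (t : ℂ) • 1) x) x).re := by
        rw [hform, Complex.sub_re, Complex.re_ofReal_mul, hnorm]
    _ ≤ _ := Complex.re_le_norm _

theorem hasEigenvalue_of_mem_spectrum_of_neg [CompleteSpace H] {G : H →L[ℂ] H}
    {E : Submodule ℂ H} [FiniteDimensional ℂ E]
    (hE : ∀ u ∈ Eᗮ, 0 ≤ (inner ℂ u (G u)).re) {t : ℝ} (ht : t < 0)
    (hspec : (t : ℂ) ∈ spectrum ℂ G) :
    Module.End.HasEigenvalue (G : H →ₗ[ℂ] H) (t : ℂ) := by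
  by_contra hne
  set P := E.starProjection
  set Q := Eᗮ.starProjection
  -- `G` is a finite rank perturbation of its compression to `Eᗮ`
  have hdecomp : G - (t : ℂ) • 1 = (Q ∘L G ∘L Q - (t : ℂ) • 1) + (P ∘L G + Q ∘L G ∘L P) := by
    ext x
    have hP := E.starProjection_add_starProjection_orthogonal (G x)
    have hQ := congrArg (fun y => Q (G y)) (E.starProjection_add_starProjection_orthogonal x)
    simp only [map_add] at hQ
    simp only [sub_apply, add_apply, ContinuousLinearMap.comp_apply, smul_apply,
      one_apply_eq_self]
    nth_rw 1 [← hP]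
    rw [← hQ]
    abel
  have hcompact : IsCompactOperator (P ∘L G + Q ∘L G ∘L P) :=
    ((isCompactOperator_starProjection E).comp_clm G).add
      ((isCompactOperator_starProjection E).clm_comp (Q ∘L G))
  have hunit : IsUnit (G - (t : ℂ) • 1) := by
    rw [hdecomp]
    refine isUnit_add_of_isCompactOperator (isUnit_compression_sub_smul hE ht) hcompact
      fun v hv => ?_
    rw [← hdecomp, sub_apply, sub_eq_zero] at hv
    by_contra hv0
    exact hne (Module.End.hasEigenvalue_of_hasEigenvector
      ⟨Module.End.mem_eigenspace_iff.2 hv, hv0⟩)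
  refine hspec (spectrum.mem_resolventSet_iff.2 ?_)
  rw [Algebra.algebraMap_eq_smul_one, ← neg_sub]
  exact hunit.neg

theorem negEigenspace_le_iff {G : H →L[ℂ] H} {S : Submodule ℂ H} :
    negEigenspace G ≤ S ↔ ∀ t : ℝ, t < 0 → ∀ u, G u = (t : ℂ) • u → u ∈ S := by
  simp only [negEigenspace, iSup_le_iff]
  exact forall₂_congr fun t _ => forall_congr' fun u => by
    rw [Module.End.mem_eigenspace_iff]; rfl

theorem mem_negEigenspace {G : H →L[ℂ] H} {t : ℝ} (ht : t < 0) {u : H}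
    (hu : G u = (t : ℂ) • u) : u ∈ negEigenspace G :=
  negEigenspace_le_iff.1 le_rfl t ht u hu

theorem map_mem_negEigenspace {G : H →L[ℂ] H} {u : H} (hu : u ∈ negEigenspace G) :
    G u ∈ negEigenspace G := by
  suffices negEigenspace G ≤ (negEigenspace G).comap (G : H →ₗ[ℂ] H) from this hu
  refine negEigenspace_le_iff.2 fun t ht v hv => ?_
  change G v ∈ negEigenspace G
  rw [hv]
  exact Submodule.smul_mem _ _ (mem_negEigenspace ht hv)

theorem map_mem_negEigenspace_orthogonal {G : H →L[ℂ] H}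
    (hG : (G : H →ₗ[ℂ] H).IsSymmetric) {u : H} (hu : u ∈ (negEigenspace G)ᗮ) :
    G u ∈ (negEigenspace G)ᗮ := fun v hv =>
  (hG v u).symm.trans (hu _ (map_mem_negEigenspace hv))

theorem inner_map_self_neg_of_mem_negEigenspace {G : H →L[ℂ] H}
    (hG : (G : H →ₗ[ℂ] H).IsSymmetric) {u : H} (hu : u ∈ negEigenspace G) (hu0 : u ≠ 0) :
    (inner ℂ u (G u)).re < 0 := by
  classical
  have horth := hG.orthogonalFamily_eigenspaces.comp
    (γ := {t : ℝ // t < 0}) (f := fun t => ((t : ℝ) : ℂ))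
    (Complex.ofReal_injective.comp Subtype.val_injective)
  rw [negEigenspace, iSup_subtype', Submodule.mem_iSup_iff_exists_dfinsupp'] at hu
  obtain ⟨f, rfl⟩ := hu
  set s := f.support
  change ∑ i ∈ s, (f i : H) ≠ 0 at hu0
  change (inner ℂ (∑ i ∈ s, (f i : H)) (G (∑ i ∈ s, (f i : H)))).re < 0
  have hmap : G (∑ i ∈ s, (f i : H)) = ∑ i ∈ s, ((((i : ℝ) : ℂ) • f i : _) : H) := by
    rw [map_sum]
    exact Finset.sum_congr rfl fun i _ => Module.End.mem_eigenspace_iff.1 (f i).2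
  have hform : inner ℂ (∑ i ∈ s, (f i : H)) (G (∑ i ∈ s, (f i : H))) =
      ∑ i ∈ s, inner ℂ (f i) (((i : ℝ) : ℂ) • f i) := by
    rw [hmap]; exact horth.inner_sum (fun i => f i) (fun i => ((i : ℝ) : ℂ) • f i) s
  rw [hform, Complex.re_sum]
  refine Finset.sum_neg (fun i hi => ?_) (Finset.nonempty_of_sum_ne_zero hu0)
  have hnorm : (inner ℂ (f i) (f i)).re = ‖f i‖ ^ 2 := inner_self_eq_norm_sq (𝕜 := ℂ) (f i)
  have hpos : 0 < ‖f i‖ := norm_pos_iff.2 (DFinsupp.mem_support_iff.1 hi)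
  rw [inner_smul_right, Complex.re_ofReal_mul, hnorm]
  exact mul_neg_of_neg_of_pos i.2 (by positivity)

theorem finrank_le_of_disjoint_orthogonal {𝕜 V : Type*} [RCLike 𝕜] [NormedAddCommGroup V]
    [InnerProductSpace 𝕜 V] {E W : Submodule 𝕜 V} [FiniteDimensional 𝕜 E] (h : Disjoint W Eᗮ) :
    FiniteDimensional 𝕜 W ∧ Module.finrank 𝕜 W ≤ Module.finrank 𝕜 E := by
  let f : W →ₗ[𝕜] E := (E.orthogonalProjectionOnto : V →ₗ[𝕜] E) ∘ₗ W.subtype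
  have hf : Function.Injective f := by
    refine (injective_iff_map_eq_zero f).2 fun u hu => Subtype.ext ?_
    exact Submodule.disjoint_def.1 h u u.2 (Submodule.orthogonalProjectionOnto_eq_zero_iff.1 hu)
  exact ⟨FiniteDimensional.of_injective f hf, LinearMap.finrank_le_finrank_of_injective hf⟩

theorem disjoint_of_re_neg_of_re_nonneg {G : H →L[ℂ] H} {W U : Submodule ℂ H}
    (hW : ∀ u ∈ W, u ≠ 0 → (inner ℂ u (G u)).re < 0)
    (hU : ∀ u ∈ U, 0 ≤ (inner ℂ u (G u)).re) : Disjoint W U :=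
  Submodule.disjoint_def.2 fun u huW huU =>
    by_contra fun hu0 => (hW u huW hu0).not_ge (hU u huU)

theorem finrank_negEigenspace_le {G : H →L[ℂ] H} (hG : (G : H →ₗ[ℂ] H).IsSymmetric)
    {E : Submodule ℂ H} [FiniteDimensional ℂ E]
    (hE : ∀ u ∈ Eᗮ, 0 ≤ (inner ℂ u (G u)).re) :
    FiniteDimensional ℂ (negEigenspace G) ∧
      Module.finrank ℂ (negEigenspace G) ≤ Module.finrank ℂ E :=
  finrank_le_of_disjoint_orthogonal <| disjoint_of_re_neg_of_re_nonneg
    (fun _ => inner_map_self_neg_of_mem_negEigenspace hG) hE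

theorem compression_apply_of_mem_negEigenspace_orthogonal {G : H →L[ℂ] H}
    [(negEigenspace G)ᗮ.HasOrthogonalProjection] (hG : (G : H →ₗ[ℂ] H).IsSymmetric) {u : H}
    (hu : u ∈ (negEigenspace G)ᗮ) :
    ((negEigenspace G)ᗮ.starProjection ∘L G ∘L (negEigenspace G)ᗮ.starProjection) u = G u := by
  simp only [ContinuousLinearMap.comp_apply]
  rw [Submodule.starProjection_eq_self_iff.2 hu,
    Submodule.starProjection_eq_self_iff.2 (map_mem_negEigenspace_orthogonal hG hu)]

theorem isPositive_compression_negEigenspace_orthogonal [CompleteSpace H] {G : H →L[ℂ] H}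
    (hG : IsSelfAdjoint G) {E : Submodule ℂ H} [FiniteDimensional ℂ E]
    [FiniteDimensional ℂ (negEigenspace G)] (hE : ∀ u ∈ Eᗮ, 0 ≤ (inner ℂ u (G u)).re) :
    ((negEigenspace G)ᗮ.starProjection ∘L G ∘L (negEigenspace G)ᗮ.starProjection).IsPositive := by
  set V := negEigenspace G
  set G' : H →L[ℂ] H := Vᗮ.starProjection ∘L G ∘L Vᗮ.starProjection
  have hG'V : ∀ x ∈ Vᗮ, G' x = G x := fun x =>
    compression_apply_of_mem_negEigenspace_orthogonal hG.isSymmetric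
  have hE' : ∀ x ∈ (E ⊔ V)ᗮ, 0 ≤ (inner ℂ x (G' x)).re := fun x hx => by
    rw [hG'V x (Submodule.orthogonal_le le_sup_right hx)]
    exact hE x (Submodule.orthogonal_le le_sup_left hx)
  -- a negative eigenvalue of the compression would be one of `G` as well
  have hspec : ∀ t ∈ spectrum ℝ G', 0 ≤ t := fun t ht => by
    by_contra! hneg
    obtain ⟨v, hv, hv0⟩ := (hasEigenvalue_of_mem_spectrum_of_neg hE' hneg
      ((spectrum.algebraMap_mem_iff ℂ).2 ht)).exists_hasEigenvector
    have hv' : G' v = (t : ℂ) • v := Module.End.mem_eigenspace_iff.1 hv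
    have hvV : v ∈ Vᗮ := by
      have hG'v : G' v ∈ Vᗮ := Vᗮ.starProjection_apply_mem _
      rw [hv'] at hG'v
      exact (Submodule.smul_mem_iff _ (Complex.ofReal_ne_zero.2 hneg.ne)).1 hG'v
    have hvV' : v ∈ V := mem_negEigenspace hneg ((hG'V v hvV).symm.trans hv')
    exact hv0 (inner_self_eq_zero.1 (hvV v hvV'))
  rw [← ContinuousLinearMap.nonneg_iff_isPositive]
  exact nonneg_iff_isSelfAdjoint_and_quasispectrumRestricts.2
    ⟨hG.conj_starProjection Vᗮ,
      quasispectrumRestricts_iff_spectrumRestricts.2 <| SpectrumRestricts.nnreal_iff.2 hspec⟩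

theorem inner_map_self_nonneg_of_mem_negEigenspace_orthogonal [CompleteSpace H] {G : H →L[ℂ] H}
    (hG : IsSelfAdjoint G) {E : Submodule ℂ H} [FiniteDimensional ℂ E]
    (hE : ∀ u ∈ Eᗮ, 0 ≤ (inner ℂ u (G u)).re) {u : H} (hu : u ∈ (negEigenspace G)ᗮ) :
    0 ≤ (inner ℂ u (G u)).re := by
  have := (finrank_negEigenspace_le hG.isSymmetric hE).1
  have hpos := (isPositive_compression_negEigenspace_orthogonal hG hE).re_inner_nonneg_right u
  rwa [compression_apply_of_mem_negEigenspace_orthogonal hG.isSymmetric hu] at hpos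

/-- Glazman's lemma. -/
theorem rank_negEigenspace_of_dense_sup [CompleteSpace H] {G : H →L[ℂ] H} (hG : IsSelfAdjoint G)
    {D F W : Submodule ℂ H} [FiniteDimensional ℂ F] (hdense : (D ⊔ F)ᗮ = ⊥)
    (hD : ∀ u ∈ D, 0 ≤ (inner ℂ u (G u)).re)
    (hW : ∀ u ∈ W, u ≠ 0 → (inner ℂ u (G u)).re < 0)
    {N : ℕ} (hFN : Module.finrank ℂ F ≤ N) (hWN : N ≤ Module.finrank ℂ W) :
    (∀ t : ℝ, t < 0 → (t : ℂ) ∈ spectrum ℂ G →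
      Module.End.HasEigenvalue (G : H →ₗ[ℂ] H) (t : ℂ)) ∧
    Module.rank ℂ (negEigenspace G) = (N : Cardinal) := by
  obtain ⟨hDfin, hDF⟩ := finrank_le_of_disjoint_orthogonal (E := F) (W := Dᗮ)
    (disjoint_iff.2 (by rw [Submodule.inf_orthogonal, hdense]))
  have hE : ∀ u ∈ Dᗮᗮ, 0 ≤ (inner ℂ u (G u)).re := fun u hu => by
    rw [Submodule.orthogonal_orthogonal_eq_closure] at hu
    exact closure_minimal (t := {u : H | 0 ≤ (inner ℂ u (G u)).re}) hD
      (isClosed_le continuous_const (by fun_prop)) hu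
  obtain ⟨hfin, hle⟩ := finrank_negEigenspace_le hG.isSymmetric hE
  have hge := (finrank_le_of_disjoint_orthogonal (disjoint_of_re_neg_of_re_nonneg hW
    fun u => inner_map_self_nonneg_of_mem_negEigenspace_orthogonal hG hE)).2
  refine ⟨fun t ht hs => hasEigenvalue_of_mem_spectrum_of_neg hE ht hs, ?_⟩
  rw [← Module.finrank_eq_rank, Nat.cast_inj]
  omega

theorem map_eq_zero_of_isPositive_of_re_inner_eq_zero [CompleteSpace H] {T : H →L[ℂ] H}
    (hT : T.IsPositive) {u : H} (hu : (inner ℂ u (T u)).re = 0) : T u = 0 := by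
  obtain ⟨S, rfl⟩ := CStarAlgebra.nonneg_iff_eq_star_mul_self.1
    ((ContinuousLinearMap.nonneg_iff_isPositive T).2 hT)
  have hform : (inner ℂ u ((star S * S) u)).re = ‖S u‖ ^ 2 := by
    rw [ContinuousLinearMap.star_eq_adjoint, mul_apply_eq_comp,
      ContinuousLinearMap.adjoint_inner_right]
    exact inner_self_eq_norm_sq (𝕜 := ℂ) (S u)
  have hSu : S u = 0 := norm_eq_zero.1 (pow_eq_zero_iff two_ne_zero |>.1 (hform.symm.trans hu))
  rw [mul_apply_eq_comp, hSu, map_zero]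

theorem finrank_le_finrank_negEigenspace_of_nonpos [FiniteDimensional ℂ H] [CompleteSpace H]
    {T : H →L[ℂ] H} (hT : IsSelfAdjoint T) (hinj : ∀ u, T u = 0 → u = 0) {U : Submodule ℂ H}
    (hU : ∀ u ∈ U, (inner ℂ u (T u)).re ≤ 0) :
    Module.finrank ℂ U ≤ Module.finrank ℂ (negEigenspace T) := by
  refine (finrank_le_of_disjoint_orthogonal <| Submodule.disjoint_def.2 fun u hu hu' =>
    hinj u ?_).2
  have hpos := isPositive_compression_negEigenspace_orthogonal hT (E := ⊤) (by simp)
  have hT'u := compression_apply_of_mem_negEigenspace_orthogonal hT.isSymmetric hu'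
  rw [← hT'u]
  refine map_eq_zero_of_isPositive_of_re_inner_eq_zero hpos (le_antisymm ?_ ?_)
  · rw [hT'u]; exact hU u hu
  · exact hpos.re_inner_nonneg_right u

theorem exists_re_inner_le_neg_mul_norm_sq {T : H →L[ℂ] H} {W : Submodule ℂ H}
    [FiniteDimensional ℂ W] (hW : ∀ u ∈ W, u ≠ 0 → (inner ℂ u (T u)).re < 0) :
    ∃ δ > 0, ∀ u ∈ W, (inner ℂ u (T u)).re ≤ -δ * ‖u‖ ^ 2 := by
  have := FiniteDimensional.proper ℂ W
  obtain ⟨δ, hδ, hsphere⟩ := (isCompact_sphere (0 : W) 1).exists_forall_le'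
    (f := fun u : W => -(inner ℂ (u : H) (T u)).re) (by fun_prop)
    (a := 0) fun u hu => neg_pos.2 <| hW u u.2 fun h0 => by
      rw [mem_sphere_zero_iff_norm, Submodule.coe_norm, h0, norm_zero] at hu
      exact zero_ne_one hu
  refine ⟨δ, hδ, fun u hu => ?_⟩
  rcases eq_or_ne u 0 with rfl | hu0
  · simp
  have hunit := hsphere (((‖u‖⁻¹ : ℝ) : ℂ) • ⟨u, hu⟩) (by
    rw [mem_sphere_zero_iff_norm, norm_smul, Complex.norm_real, norm_inv, norm_norm]
    exact inv_mul_cancel₀ (norm_ne_zero_iff.2 hu0))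
  simp only [Submodule.coe_smul, map_smul, inner_smul_left, inner_smul_right,
    Complex.conj_ofReal, Complex.re_ofReal_mul] at hunit
  have hpos : 0 < ‖u‖ := norm_pos_iff.2 hu0
  field_simp at hunit
  linarith

end NegativeSpectrum

open Polynomial

section ConjPoly

/-- The polynomial whose coefficients are the complex conjugates of those of `p`. On the real line
it takes the conjugate values. -/
noncomputable def conjPoly (p : ℂ[X]) : ℂ[X] := p.map (starRingEnd ℂ)

@[simp] theorem conjPoly_add (p q : ℂ[X]) : conjPoly (p + q) = conjPoly p + conjPoly q :=
  Polynomial.map_add _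

@[simp] theorem conjPoly_mul (p q : ℂ[X]) : conjPoly (p * q) = conjPoly p * conjPoly q :=
  Polynomial.map_mul _

@[simp] theorem conjPoly_pow (p : ℂ[X]) (n : ℕ) : conjPoly (p ^ n) = conjPoly p ^ n :=
  Polynomial.map_pow _ _

@[simp] theorem conjPoly_X_sub_C (b : ℂ) :
    conjPoly (X - C b) = X - C ((starRingEnd ℂ) b) := by
  simp [conjPoly]

@[simp] theorem conjPoly_conjPoly (p : ℂ[X]) : conjPoly (conjPoly p) = p := by
  ext; simp [conjPoly]

theorem conjPoly_dvd_conjPoly {p q : ℂ[X]} (h : p ∣ q) : conjPoly p ∣ conjPoly q :=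
  Polynomial.map_dvd _ h

theorem eval_conj_conjPoly (p : ℂ[X]) (z : ℂ) :
    (conjPoly p).eval ((starRingEnd ℂ) z) = (starRingEnd ℂ) (p.eval z) := by
  rw [conjPoly, eval_map, eval₂_at_apply]

theorem eval_mul_conjPoly_of_im_eq_zero (p : ℂ[X]) {z : ℂ} (hz : z.im = 0) :
    (p * conjPoly p).eval z = ((‖p.eval z‖ ^ 2 : ℝ) : ℂ) := by
  have hconj := eval_conj_conjPoly p z
  rw [Complex.conj_eq_iff_im.2 hz] at hconj
  rw [eval_mul, hconj, Complex.mul_conj, Complex.normSq_eq_norm_sq]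

end ConjPoly

theorem two_mul_negCount (K : ℕ) (p : ℝ) :
    2 * negCount K p = if Odd K then K + 1 else if 0 < p then K else K + 2 := by
  unfold negCount
  split_ifs with h1 h2
  · obtain ⟨m, rfl⟩ := h1; omega
  · obtain ⟨m, rfl⟩ := Nat.not_odd_iff_even.1 h1; omega
  · obtain ⟨m, rfl⟩ := Nat.not_odd_iff_even.1 h1; omega

theorem negCount_add_negCount_neg (K : ℕ) {p : ℝ} (hp : p ≠ 0) :
    negCount K p + negCount K (-p) = K + 1 := by
  have h1 := two_mul_negCount K p
  have h2 := two_mul_negCount K (-p)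
  rcases lt_or_gt_of_ne hp with h | h
  · simp only [h.not_gt, Left.neg_pos_iff, h, if_true, if_false] at h1 h2
    split_ifs at h1 h2 <;> omega
  · simp only [h, Left.neg_pos_iff, h.not_gt, if_true, if_false] at h1 h2
    split_ifs at h1 h2 <;> omega

section NodePoly

variable {ι : Type*} [Fintype ι] {β : ι → ℂ}

/-- The monic polynomial with the roots `β i` of multiplicity `e i`. -/
noncomputable def nodePoly (β : ι → ℂ) (e : ι → ℕ) : ℂ[X] := ∏ i, (X - C (β i)) ^ e i

theorem monic_nodePoly (β : ι → ℂ) (e : ι → ℕ) : (nodePoly β e).Monic :=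
  monic_prod_of_monic _ _ fun _ _ => (monic_X_sub_C _).pow _

theorem natDegree_nodePoly (β : ι → ℂ) (e : ι → ℕ) : (nodePoly β e).natDegree = ∑ i, e i := by
  rw [nodePoly, natDegree_prod_of_monic _ _ fun i _ => (monic_X_sub_C _).pow _]
  simp only [natDegree_pow, natDegree_X_sub_C, mul_one]

theorem pow_dvd_nodePoly (β : ι → ℂ) (e : ι → ℕ) (i : ι) :
    (X - C (β i)) ^ e i ∣ nodePoly β e :=
  Finset.dvd_prod_of_mem (fun i => (X - C (β i)) ^ e i) (Finset.mem_univ i)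

theorem nodePoly_dvd (hβ : Function.Injective β) {e : ι → ℕ} {p : ℂ[X]}
    (h : ∀ i, (X - C (β i)) ^ e i ∣ p) : nodePoly β e ∣ p :=
  Finset.prod_dvd_of_coprime (fun _ _ _ _ hij => (pairwise_coprime_X_sub_C hβ hij).pow)
    fun i _ => h i

theorem rootMultiplicity_nodePoly (hβ : Function.Injective β) (e : ι → ℕ) (i : ι) :
    rootMultiplicity (β i) (nodePoly β e) = e i := by
  classical
  rw [← count_roots, nodePoly, roots_prod _ _ (monic_nodePoly β e).ne_zero]
  simp only [roots_pow, roots_X_sub_C, Multiset.count_bind, Multiset.count_nsmul,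
    Multiset.count_singleton, hβ.eq_iff]
  simp

theorem exists_eq_of_isRoot_nodePoly {e : ι → ℕ} {b : ℂ} (h : (nodePoly β e).IsRoot b) :
    ∃ i, β i = b := by
  rw [IsRoot, nodePoly, eval_prod, Finset.prod_eq_zero_iff] at h
  obtain ⟨i, -, hi⟩ := h
  rw [eval_pow, eval_sub, eval_X, eval_C] at hi
  exact ⟨i, (sub_eq_zero.1 (eq_zero_of_pow_eq_zero hi)).symm⟩

theorem eval_nodePoly_ne_zero (hβ : Function.Injective β) {e : ι → ℕ} {i : ι} (hi : e i = 0) :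
    (nodePoly β e).eval (β i) ≠ 0 := fun h => by
  have hpos := (rootMultiplicity_pos (monic_nodePoly β e).ne_zero).2 h
  rw [rootMultiplicity_nodePoly hβ, hi] at hpos
  exact hpos.false

end NodePoly

/-- The functional `ℓ` depends on the jet of order `k` at `b` only, and it sends `(X - b) ^ k` to
`c ≠ 0`. -/
structure IsJet (b : ℂ) (k : ℕ) (c : ℂ) (ℓ : ℂ[X] →ₗ[ℂ] ℂ) : Prop where
  coeff_ne_zero : c ≠ 0
  apply_pow_mul : ∀ f, ℓ ((X - C b) ^ k * f) = c * f.eval b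

namespace IsJet

variable {b c : ℂ} {k : ℕ} {ℓ : ℂ[X] →ₗ[ℂ] ℂ}

theorem neg (h : IsJet b k c ℓ) : IsJet b k (-c) (-ℓ) where
  coeff_ne_zero := neg_ne_zero.2 h.coeff_ne_zero
  apply_pow_mul f := by rw [LinearMap.neg_apply, h.apply_pow_mul, neg_mul]

theorem apply_eq_zero_of_dvd (h : IsJet b k c ℓ) {f : ℂ[X]} (hf : (X - C b) ^ (k + 1) ∣ f) :
    ℓ f = 0 := by
  obtain ⟨g, rfl⟩ := hf
  rw [pow_succ, mul_assoc, h.apply_pow_mul, eval_mul, eval_sub, eval_X, eval_C, sub_self,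
    zero_mul, mul_zero]

theorem dvd_of_forall (h : IsJet b k c ℓ) {f : ℂ[X]} (hf : ∀ g, ℓ (f * g) = 0) :
    (X - C b) ^ (k + 1) ∣ f := by
  rcases eq_or_ne f 0 with rfl | hf0
  · exact dvd_zero _
  rw [← le_rootMultiplicity_iff hf0]
  by_contra! hlt
  obtain ⟨w, hw, hndvd⟩ := exists_eq_pow_rootMultiplicity_mul_and_not_dvd f hf0 b
  set m := rootMultiplicity b f
  have hfw : f * (X - C b) ^ (k - m) = (X - C b) ^ k * w := by
    rw [hw, mul_right_comm, ← pow_add, Nat.add_sub_cancel' (Nat.le_of_lt_succ hlt)]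
  have happly := hf ((X - C b) ^ (k - m))
  rw [hfw, h.apply_pow_mul] at happly
  exact hndvd (dvd_iff_isRoot.2 ((mul_eq_zero.1 happly).resolve_left h.coeff_ne_zero))

theorem re_apply_mul_conjPoly_nonneg (h : IsJet b k c ℓ) (hb : b.im = 0) {u : ℂ[X]}
    (hu : (X - C b) ^ negCount k c.re ∣ u) : 0 ≤ (ℓ (u * conjPoly u)).re := by
  have hconj : (starRingEnd ℂ) b = b := Complex.conj_eq_iff_im.2 hb
  obtain ⟨w, rfl⟩ := hu
  set m := negCount k c.re
  have hsquare : (X - C b) ^ m * w * conjPoly ((X - C b) ^ m * w) =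
      (X - C b) ^ (2 * m) * (w * conjPoly w) := by
    simp only [conjPoly_mul, conjPoly_pow, conjPoly_X_sub_C, hconj]
    ring
  have hm := two_mul_negCount k c.re
  rw [hsquare]
  split_ifs at hm with hodd hpos
  · rw [h.apply_eq_zero_of_dvd ((pow_dvd_pow _ hm.ge).mul_right _), Complex.zero_re]
  · rw [show 2 * m = k from hm, h.apply_pow_mul, eval_mul_conjPoly_of_im_eq_zero _ hb,
      Complex.re_mul_ofReal]
    positivity
  · rw [h.apply_eq_zero_of_dvd ((pow_dvd_pow _ (by omega)).mul_right _), Complex.zero_re]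

end IsJet

/-- The `L i` are jets at distinct points and their sum is real on real polynomials. -/
structure IsRealJetFamily {ι : Type*} [Fintype ι] (β : ι → ℂ) (K : ι → ℕ) (c : ι → ℂ)
    (L : ι → ℂ[X] →ₗ[ℂ] ℂ) : Prop where
  injective : Function.Injective β
  isJet : ∀ i, IsJet (β i) (K i) (c i) (L i)
  sum_conjPoly : ∀ f, ∑ i, L i (conjPoly f) = (starRingEnd ℂ) (∑ i, L i f)

/-- The number of negative squares which a jet at `b` of order `k` with top coefficient `c`
contributes to the form `u ↦ ∑ i, L i (u * conjPoly u)` of a real jet family, that of a pair of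
conjugate nodes being attributed to the one in the upper half-plane. -/
noncomputable def negMultiplicity (b : ℂ) (k : ℕ) (c : ℂ) : ℕ :=
  if b.im = 0 then negCount k c.re else if 0 < b.im then k + 1 else 0

namespace IsRealJetFamily

variable {ι : Type*} [Fintype ι] {β : ι → ℂ} {K : ι → ℕ} {c : ι → ℂ} {L : ι → ℂ[X] →ₗ[ℂ] ℂ}

theorem neg (h : IsRealJetFamily β K c L) :
    IsRealJetFamily β K (fun i => -c i) (fun i => -L i) where
  injective := h.injective
  isJet i := (h.isJet i).neg
  sum_conjPoly f := by
    simp only [LinearMap.neg_apply, Finset.sum_neg_distrib, map_neg, h.sum_conjPoly]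

theorem sum_apply_eq_zero_of_dvd (h : IsRealJetFamily β K c L) {f : ℂ[X]}
    (hf : nodePoly β (fun i => K i + 1) ∣ f) : ∑ i, L i f = 0 :=
  Finset.sum_eq_zero fun i _ => (h.isJet i).apply_eq_zero_of_dvd
    ((pow_dvd_nodePoly β (fun i => K i + 1) i).trans hf)

theorem sum_apply_eq_single [DecidableEq ι] (h : IsRealJetFamily β K c L) (i : ι) {f : ℂ[X]}
    (hf : nodePoly β (Function.update (fun j => K j + 1) i 0) ∣ f) : ∑ j, L j f = L i f := by
  refine Finset.sum_eq_single_of_mem i (Finset.mem_univ i) fun j _ hj =>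
    (h.isJet j).apply_eq_zero_of_dvd ?_
  simpa only [Function.update_of_ne hj] using (pow_dvd_nodePoly β _ j).trans hf

theorem nodePoly_dvd_of_forall (h : IsRealJetFamily β K c L) {u : ℂ[X]}
    (hu : ∀ v, ∑ i, L i (u * v) = 0) : nodePoly β (fun i => K i + 1) ∣ u := by
  classical
  refine nodePoly_dvd h.injective fun i => ?_
  set r := nodePoly β (Function.update (fun j => K j + 1) i 0)
  have hdvd : (X - C (β i)) ^ (K i + 1) ∣ r * u := (h.isJet i).dvd_of_forall fun g => by
    rw [← h.sum_apply_eq_single i ((dvd_mul_right _ _).mul_right g), mul_right_comm, mul_comm]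
    exact hu _
  refine IsCoprime.dvd_of_dvd_mul_left (IsCoprime.pow_left ?_) hdvd
  rw [(irreducible_X_sub_C (β i)).coprime_iff_not_dvd, dvd_iff_isRoot]
  exact eval_nodePoly_ne_zero h.injective (Function.update_self ..)

theorem conjPoly_nodePoly (h : IsRealJetFamily β K c L) :
    conjPoly (nodePoly β fun i => K i + 1) = nodePoly β fun i => K i + 1 := by
  set q := nodePoly β fun i => K i + 1
  have hq : q.Monic := monic_nodePoly _ _
  have hdvd : q ∣ conjPoly q := h.nodePoly_dvd_of_forall fun v => by
    have hmul : conjPoly q * v = conjPoly (q * conjPoly v) := by simp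
    rw [hmul, h.sum_conjPoly, h.sum_apply_eq_zero_of_dvd (dvd_mul_right _ _), map_zero]
  exact eq_of_monic_of_dvd_of_natDegree_le hq (hq.map _) hdvd natDegree_map_le

theorem exists_conj (h : IsRealJetFamily β K c L) (i : ι) :
    ∃ j, β j = (starRingEnd ℂ) (β i) ∧ K j = K i := by
  set q := nodePoly β fun i => K i + 1
  have hmult : rootMultiplicity ((starRingEnd ℂ) (β i)) q = K i + 1 := by
    calc rootMultiplicity ((starRingEnd ℂ) (β i)) q
        = rootMultiplicity ((starRingEnd ℂ) (β i)) (conjPoly q) := by rw [h.conjPoly_nodePoly]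
      _ = rootMultiplicity (β i) q :=
        (eq_rootMultiplicity_map (starRingEnd ℂ).injective _).symm
      _ = K i + 1 := rootMultiplicity_nodePoly h.injective _ i
  have hroot : q.IsRoot ((starRingEnd ℂ) (β i)) :=
    (rootMultiplicity_pos (monic_nodePoly _ _).ne_zero).1 (hmult ▸ Nat.succ_pos _)
  obtain ⟨j, hj⟩ := exists_eq_of_isRoot_nodePoly hroot
  rw [← hj, rootMultiplicity_nodePoly h.injective] at hmult
  exact ⟨j, hj, Nat.succ.inj hmult⟩

theorem coeff_im_eq_zero (h : IsRealJetFamily β K c L) {i : ι} (hi : (β i).im = 0) :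
    (c i).im = 0 := by
  classical
  set r := nodePoly β (Function.update (fun j => K j + 1) i 0)
  set f : ℂ[X] := (X - C (β i)) ^ K i * (r * conjPoly r)
  have hf : conjPoly f = f := by simp [f, Complex.conj_eq_iff_im.2 hi, mul_comm]
  have hsum : ∑ j, L j f = c i * ((‖r.eval (β i)‖ ^ 2 : ℝ) : ℂ) := by
    rw [h.sum_apply_eq_single i ((dvd_mul_right r _).mul_left _), (h.isJet i).apply_pow_mul,
      eval_mul_conjPoly_of_im_eq_zero _ hi]
  have hreal := h.sum_conjPoly f
  rw [hf, eq_comm, Complex.conj_eq_iff_im, hsum, Complex.im_mul_ofReal] at hreal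
  have hr : r.eval (β i) ≠ 0 := eval_nodePoly_ne_zero h.injective (Function.update_self ..)
  exact (mul_eq_zero.1 hreal).resolve_right (by positivity)

theorem coeff_re_ne_zero (h : IsRealJetFamily β K c L) {i : ι} (hi : (β i).im = 0) :
    (c i).re ≠ 0 := fun h0 =>
  (h.isJet i).coeff_ne_zero (Complex.ext h0 (h.coeff_im_eq_zero hi))

theorem re_sum_apply_mul_conjPoly_nonneg (h : IsRealJetFamily β K c L) {e : ι → ℕ}
    (he : ∀ i, (β i).im = 0 → e i = negCount (K i) (c i).re)
    (he' : ∀ i, (β i).im ≠ 0 →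
      K i + 1 ≤ e i ∨ ∃ j, β j = (starRingEnd ℂ) (β i) ∧ K i + 1 ≤ e j)
    {u : ℂ[X]} (hu : nodePoly β e ∣ u) : 0 ≤ (∑ i, L i (u * conjPoly u)).re := by
  rw [Complex.re_sum]
  refine Finset.sum_nonneg fun i _ => ?_
  have hdvd : ∀ j, (X - C (β j)) ^ e j ∣ u := fun j => (pow_dvd_nodePoly β e j).trans hu
  by_cases hi : (β i).im = 0
  · exact (h.isJet i).re_apply_mul_conjPoly_nonneg hi (he i hi ▸ hdvd i)
  · refine (congrArg Complex.re ((h.isJet i).apply_eq_zero_of_dvd ?_)).ge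
    rcases he' i hi with hle | ⟨j, hj, hle⟩
    · exact ((pow_dvd_pow _ hle).trans (hdvd i)).mul_right _
    · have hconj := conjPoly_dvd_conjPoly ((pow_dvd_pow _ hle).trans (hdvd j))
      simp only [conjPoly_pow, conjPoly_X_sub_C, hj, Complex.conj_conj] at hconj
      exact hconj.mul_left _

theorem negMultiplicity_le (h : IsRealJetFamily β K c L) (i : ι) :
    negMultiplicity (β i) (K i) (c i) ≤ K i + 1 := by
  unfold negMultiplicity
  split_ifs with hreal hpos
  · have := negCount_add_negCount_neg (K i) (h.coeff_re_ne_zero hreal)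
    omega
  · rfl
  · exact Nat.zero_le _

theorem negMultiplicity_add_of_conj (h : IsRealJetFamily β K c L) {i : ι} (hi : (β i).im ≠ 0) :
    ∃ j, β j = (starRingEnd ℂ) (β i) ∧ K j = K i ∧
      negMultiplicity (β i) (K i) (c i) + negMultiplicity (β j) (K j) (c j) = K i + 1 := by
  obtain ⟨j, hj, hK⟩ := h.exists_conj i
  have him : (β j).im = -(β i).im := by rw [hj, Complex.conj_im]
  refine ⟨j, hj, hK, ?_⟩
  simp only [negMultiplicity, him, neg_eq_zero, if_neg hi, Left.neg_pos_iff, hK]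
  rcases lt_or_gt_of_ne hi with hneg | hpos
  · simp only [hneg, hneg.not_gt, if_true, if_false, zero_add]
  · simp only [hpos, hpos.not_gt, if_true, if_false, add_zero]

theorem re_sum_apply_mul_conjPoly_nonneg_of_negMultiplicity (h : IsRealJetFamily β K c L)
    {u : ℂ[X]} (hu : nodePoly β (fun i => negMultiplicity (β i) (K i) (c i)) ∣ u) :
    0 ≤ (∑ i, L i (u * conjPoly u)).re := by
  refine h.re_sum_apply_mul_conjPoly_nonneg (fun i hi => if_pos hi) (fun i hi => ?_) hu
  obtain ⟨j, hj, -, hadd⟩ := h.negMultiplicity_add_of_conj hi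
  by_cases hpos : 0 < (β i).im
  · left; simp only [if_neg hi, if_pos hpos, le_refl]
  · right
    rw [negMultiplicity, if_neg hi, if_neg hpos, zero_add] at hadd
    exact ⟨j, hj, hadd.ge⟩

theorem re_sum_apply_mul_conjPoly_nonpos_of_sub_negMultiplicity (h : IsRealJetFamily β K c L)
    {u : ℂ[X]} (hu : nodePoly β (fun i => K i + 1 - negMultiplicity (β i) (K i) (c i)) ∣ u) :
    (∑ i, L i (u * conjPoly u)).re ≤ 0 := by
  suffices hneg : 0 ≤ (∑ i, (-L i) (u * conjPoly u)).re by simpa using hneg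
  refine h.neg.re_sum_apply_mul_conjPoly_nonneg (fun i hi => ?_) (fun i hi => ?_) hu
  · have := negCount_add_negCount_neg (K i) (h.coeff_re_ne_zero hi)
    rw [negMultiplicity, if_pos hi, Complex.neg_re]
    omega
  · obtain ⟨j, hj, hK, hadd⟩ := h.negMultiplicity_add_of_conj hi
    by_cases hpos : 0 < (β i).im
    · refine Or.inr ⟨j, hj, ?_⟩
      rw [negMultiplicity, if_neg hi, if_pos hpos] at hadd
      omega
    · left; rw [negMultiplicity, if_neg hi, if_neg hpos, Nat.sub_zero]

end IsRealJetFamily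

section Approximation

theorem continuous_eval_ofReal (p : ℂ[X]) : Continuous fun t : ℝ => p.eval (t : ℂ) :=
  p.continuous.comp Complex.continuous_ofReal

theorem ae_eval_ofReal_ne_zero {p : ℂ[X]} (hp : p ≠ 0) : ∀ᵐ t : ℝ, p.eval (t : ℂ) ≠ 0 := by
  have hfin : {t : ℝ | p.eval (t : ℂ) = 0}.Finite :=
    (p.finite_setOfPred_isRoot hp).preimage Complex.ofReal_injective.injOn
  simpa [ae_iff] using hfin.measure_zero volume

/-- `e` is a large power of `1 - |q|² / M`, which is less than `1` in modulus almost everywhere. -/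
theorem exists_dvd_one_sub_integral_norm_sq_lt {q : ℂ[X]} (hq : q ≠ 0) (a b : ℝ) {ε : ℝ}
    (hε : 0 < ε) :
    ∃ e : ℂ[X], q ∣ 1 - e ∧ conjPoly e = e ∧ ∫ t in a..b, ‖e.eval (t : ℂ)‖ ^ 2 < ε := by
  obtain ⟨B, hB⟩ := isCompact_uIcc.exists_bound_of_continuousOn
    ((continuous_eval_ofReal q).pow 2).continuousOn (s := Set.uIcc a b)
  set M : ℝ := |B| + 1
  have hM : 0 < M := by positivity
  set s : ℝ → ℝ := fun t => 1 - ‖q.eval (t : ℂ)‖ ^ 2 / M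
  set g : ℂ[X] := 1 - C ((M⁻¹ : ℝ) : ℂ) * (q * conjPoly q)
  have hg : ∀ t : ℝ, g.eval (t : ℂ) = (s t : ℂ) := fun t => by
    rw [eval_sub, eval_mul, eval_one, eval_C, eval_mul_conjPoly_of_im_eq_zero q (by simp)]
    simp only [s]
    push_cast
    ring
  have hs : ∀ t ∈ Set.uIoc a b, 0 ≤ s t ∧ s t ≤ 1 := fun t ht => by
    have hbound := hB t (Set.uIoc_subset_uIcc ht)
    rw [Pi.pow_apply, norm_pow] at hbound
    exact ⟨sub_nonneg.2 <| (div_le_one hM).2 <| by linarith [le_abs_self B],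
      sub_le_self _ (by positivity)⟩
  have hlim : Filter.Tendsto (fun n : ℕ => ∫ t in a..b, ‖(g ^ n).eval (t : ℂ)‖ ^ 2)
      Filter.atTop (nhds (∫ _ in a..b, (0 : ℝ))) := by
    refine intervalIntegral.tendsto_integral_filter_of_dominated_convergence (fun _ => 1)
      (.of_forall fun n => ((continuous_eval_ofReal (g ^ n)).norm.pow 2).aestronglyMeasurable)
      (.of_forall fun n => .of_forall fun t ht => ?_) intervalIntegrable_const ?_
    · obtain ⟨h0, h1⟩ := hs t ht
      rw [norm_pow, norm_norm, eval_pow, hg, norm_pow, Complex.norm_of_nonneg h0]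
      exact pow_le_one₀ (by positivity) (pow_le_one₀ h0 h1)
    · filter_upwards [ae_eval_ofReal_ne_zero hq] with t hqt ht
      have hlt : s t < 1 := sub_lt_self _ (by positivity)
      simpa [hg, abs_of_nonneg (hs t ht).1] using
        (tendsto_pow_atTop_nhds_zero_of_lt_one (hs t ht).1 hlt).pow 2
  rw [intervalIntegral.integral_zero] at hlim
  obtain ⟨n, hn⟩ := (hlim.eventually_lt_const hε).exists
  have hconj : conjPoly g = g := by simp [g, conjPoly, Polynomial.map_map, mul_comm]
  have hdvd : q ∣ 1 - g := by
    rw [sub_sub_cancel]; exact (dvd_mul_right q _).mul_left _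
  exact ⟨g ^ n, hdvd.trans (one_sub_dvd_one_sub_pow g n), by rw [conjPoly_pow, hconj], hn⟩

end Approximation

section HankelForm

/-- The polynomial of degree less than `n` with the coefficients `x`. -/
noncomputable def coeffPoly (n : ℕ) : EuclideanSpace ℂ (Fin n) →ₗ[ℂ] ℂ[X] :=
  (degreeLT ℂ n).subtype ∘ₗ (degreeLTEquiv ℂ n).symm.toLinearMap ∘ₗ
    (WithLp.linearEquiv 2 ℂ (Fin n → ℂ)).toLinearMap

theorem coeffPoly_apply {n : ℕ} (x : EuclideanSpace ℂ (Fin n)) :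
    coeffPoly n x = ∑ k : Fin n, monomial (k : ℕ) (x k) :=
  rfl

theorem coeffPoly_injective (n : ℕ) : Function.Injective (coeffPoly n) :=
  Subtype.val_injective.comp
    ((degreeLTEquiv ℂ n).symm.injective.comp (WithLp.linearEquiv 2 ℂ (Fin n → ℂ)).injective)

theorem range_coeffPoly (n : ℕ) : LinearMap.range (coeffPoly n) = degreeLT ℂ n := by
  rw [coeffPoly, LinearMap.range_comp, LinearEquiv.range_comp, LinearEquiv.range,
    Submodule.map_top, Submodule.range_subtype]

theorem norm_eval_coeffPoly_sq_le {n : ℕ} (x : EuclideanSpace ℂ (Fin n)) {z : ℂ} (hz : ‖z‖ ≤ 1) :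
    ‖(coeffPoly n x).eval z‖ ^ 2 ≤ n * ‖x‖ ^ 2 := by
  have hsum : ‖(coeffPoly n x).eval z‖ ≤ ∑ k, 1 * ‖x k‖ := by
    rw [coeffPoly_apply, eval_finsetSum]
    refine (norm_sum_le _ _).trans (Finset.sum_le_sum fun k _ => ?_)
    rw [eval_monomial, norm_mul, norm_pow, mul_comm]
    exact mul_le_mul_of_nonneg_right (pow_le_one₀ (norm_nonneg _) hz) (norm_nonneg _)
  calc ‖(coeffPoly n x).eval z‖ ^ 2 ≤ (∑ k, 1 * ‖x k‖) ^ 2 := by gcongr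
    _ ≤ (∑ _k : Fin n, 1 ^ 2) * ∑ k, ‖x k‖ ^ 2 := Finset.sum_mul_sq_le_sq_mul_sq _ _ _
    _ = n * ‖x‖ ^ 2 := by simp [EuclideanSpace.norm_sq_eq]

theorem integral_norm_eval_mul_coeffPoly_sq_le {n : ℕ} (e : ℂ[X])
    (x : EuclideanSpace ℂ (Fin n)) :
    ∫ t in (-1 : ℝ)..1, ‖(e * coeffPoly n x).eval (t : ℂ)‖ ^ 2 ≤
      (∫ t in (-1 : ℝ)..1, ‖e.eval (t : ℂ)‖ ^ 2) * (n * ‖x‖ ^ 2) := by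
  have hcont : ∀ p : ℂ[X], Continuous fun t : ℝ => ‖p.eval (t : ℂ)‖ ^ 2 :=
    fun p => (continuous_eval_ofReal p).norm.pow 2
  rw [← intervalIntegral.integral_mul_const]
  refine intervalIntegral.integral_mono_on (by norm_num) ((hcont _).intervalIntegrable _ _)
    (((hcont e).mul continuous_const).intervalIntegrable _ _) fun t ht => ?_
  rw [eval_mul, norm_mul, mul_pow]
  refine mul_le_mul_of_nonneg_left (norm_eval_coeffPoly_sq_le x ?_) (by positivity)
  rw [Complex.norm_real, Real.norm_eq_abs]
  exact abs_le.2 ht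

/-- The operator on `ℂⁿ` with the Hankel matrix of the moments `Λ (X ^ j)`. -/
noncomputable def hankelCLM (n : ℕ) (Λ : ℂ[X] →ₗ[ℂ] ℂ) :
    EuclideanSpace ℂ (Fin n) →L[ℂ] EuclideanSpace ℂ (Fin n) :=
  Matrix.toEuclideanCLM (𝕜 := ℂ) (Matrix.of fun j k => Λ (X ^ ((j : ℕ) + k)))

theorem inner_hankelCLM {n : ℕ} (Λ : ℂ[X] →ₗ[ℂ] ℂ) (x y : EuclideanSpace ℂ (Fin n)) :
    inner ℂ x (hankelCLM n Λ y) = Λ (conjPoly (coeffPoly n x) * coeffPoly n y) := by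
  have hmonomial : ∀ (j k : ℕ) (a b : ℂ),
      Λ (monomial j a * monomial k b) = a * b * Λ (X ^ (j + k)) := fun j k a b => by
    rw [monomial_mul_monomial, ← C_mul_X_pow_eq_monomial, ← smul_eq_C_mul, map_smul, smul_eq_mul]
  simp only [coeffPoly_apply, conjPoly, Polynomial.map_sum, map_monomial, Finset.sum_mul,
    Finset.mul_sum, map_sum, hmonomial, PiLp.inner_apply, RCLike.inner_apply, hankelCLM,
    Matrix.ofLp_toEuclideanCLM, Matrix.mulVec, dotProduct, Matrix.of_apply]
  rw [Finset.sum_comm]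
  exact Finset.sum_congr rfl fun j _ => Finset.sum_congr rfl fun k _ => by ring

theorem isSelfAdjoint_hankelCLM {n : ℕ} {Λ : ℂ[X] →ₗ[ℂ] ℂ}
    (hΛ : ∀ f, Λ (conjPoly f) = (starRingEnd ℂ) (Λ f)) : IsSelfAdjoint (hankelCLM n Λ) := by
  rw [ContinuousLinearMap.isSelfAdjoint_iff_isSymmetric]
  intro x y
  change inner ℂ (hankelCLM n Λ x) y = inner ℂ x (hankelCLM n Λ y)
  rw [← inner_conj_symm, inner_hankelCLM, inner_hankelCLM, ← hΛ, conjPoly_mul, conjPoly_conjPoly,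
    mul_comm]

end HankelForm

namespace IsRealJetFamily

variable {ι : Type*} [Fintype ι] {β : ι → ℂ} {K : ι → ℕ} {c : ι → ℂ} {L : ι → ℂ[X] →ₗ[ℂ] ℂ}

theorem eq_zero_of_hankelCLM_eq_zero (h : IsRealJetFamily β K c L)
    {x : EuclideanSpace ℂ (Fin (∑ i, (K i + 1)))} (hx : hankelCLM _ (∑ i, L i) x = 0) :
    x = 0 := by
  set q := nodePoly β fun i => K i + 1
  have hq : q.Monic := monic_nodePoly _ _
  have hdeg : q.degree = (∑ i, (K i + 1) : ℕ) := by
    rw [degree_eq_natDegree hq.ne_zero, natDegree_nodePoly]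
  set p := coeffPoly _ x
  have hp : p.degree < q.degree := by
    rw [hdeg, ← mem_degreeLT, ← range_coeffPoly]
    exact LinearMap.mem_range_self _ x
  have hdvd : q ∣ p := h.nodePoly_dvd_of_forall fun v => by
    obtain ⟨y, hy⟩ : conjPoly (v %ₘ q) ∈ LinearMap.range (coeffPoly (∑ i, (K i + 1))) := by
      rw [range_coeffPoly, mem_degreeLT, conjPoly, Polynomial.degree_map, ← hdeg]
      exact degree_modByMonic_lt v hq
    have hmod : p * v = q * (p * (v /ₘ q)) + conjPoly (coeffPoly _ y) * p := by
      conv_lhs => rw [← modByMonic_add_div v q]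
      rw [hy, conjPoly_conjPoly]
      ring
    have hinner := inner_hankelCLM (∑ i, L i) y x
    rw [hx, inner_zero_right, LinearMap.sum_apply] at hinner
    simp only [hmod, map_add, Finset.sum_add_distrib]
    rw [h.sum_apply_eq_zero_of_dvd (dvd_mul_right _ _), zero_add]
    exact hinner.symm
  exact coeffPoly_injective _ ((eq_zero_of_dvd_of_degree_lt hdvd hp).trans (map_zero _).symm)

theorem exists_re_sum_apply_nonpos (h : IsRealJetFamily β K c L) :
    ∃ U : Submodule ℂ (EuclideanSpace ℂ (Fin (∑ i, (K i + 1)))),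
      Module.finrank ℂ U = ∑ i, negMultiplicity (β i) (K i) (c i) ∧
      ∀ x ∈ U, (∑ i, L i (coeffPoly _ x * conjPoly (coeffPoly _ x))).re ≤ 0 := by
  set n := ∑ i, (K i + 1)
  set N := ∑ i, negMultiplicity (β i) (K i) (c i)
  set r := nodePoly β fun i => K i + 1 - negMultiplicity (β i) (K i) (c i)
  have hr : r.Monic := monic_nodePoly _ _
  have hdeg : r.natDegree + N = n := by
    rw [natDegree_nodePoly, ← Finset.sum_add_distrib]
    exact Finset.sum_congr rfl fun i _ => Nat.sub_add_cancel (h.negMultiplicity_le i)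
  set ψ : EuclideanSpace ℂ (Fin N) →ₗ[ℂ] ℂ[X] := LinearMap.mulLeft ℂ r ∘ₗ coeffPoly N
  have hψ : Function.Injective ψ :=
    (mul_right_injective₀ hr.ne_zero).comp (coeffPoly_injective N)
  have hle : LinearMap.range ψ ≤ LinearMap.range (coeffPoly n) := by
    rintro _ ⟨y, rfl⟩
    have hy : coeffPoly N y ∈ degreeLT ℂ N := range_coeffPoly N ▸ LinearMap.mem_range_self _ y
    rw [mem_degreeLT] at hy
    rw [range_coeffPoly, mem_degreeLT, ← hdeg, Nat.cast_add]
    change (r * coeffPoly N y).degree < _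
    rw [degree_mul, degree_eq_natDegree hr.ne_zero]
    exact WithBot.add_lt_add_left (WithBot.natCast_ne_bot _) hy
  refine ⟨(LinearMap.range ψ).comap (coeffPoly n), ?_, ?_⟩
  · have hequiv := Submodule.equivMapOfInjective _ (coeffPoly_injective n)
      ((LinearMap.range ψ).comap (coeffPoly n))
    rw [hequiv.finrank_eq, Submodule.map_comap_eq_of_le hle, LinearMap.finrank_range_of_inj hψ,
      finrank_euclideanSpace_fin]
  · rintro x ⟨y, hy⟩
    rw [← hy]
    exact h.re_sum_apply_mul_conjPoly_nonpos_of_sub_negMultiplicity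
      ((dvd_mul_right r _).trans (dvd_refl _))

theorem exists_re_sum_apply_le_neg_mul_norm_sq (h : IsRealJetFamily β K c L) :
    ∃ (n : ℕ) (V : Submodule ℂ (EuclideanSpace ℂ (Fin n))),
      ∑ i, negMultiplicity (β i) (K i) (c i) ≤ Module.finrank ℂ V ∧ ∃ δ > 0, ∀ x ∈ V,
        (∑ i, L i (coeffPoly _ x * conjPoly (coeffPoly _ x))).re ≤ -δ * ‖x‖ ^ 2 := by
  set T := hankelCLM (∑ i, (K i + 1)) (∑ i, L i)
  have hT : IsSelfAdjoint T := isSelfAdjoint_hankelCLM fun f => by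
    rw [LinearMap.sum_apply, LinearMap.sum_apply, h.sum_conjPoly]
  have hinner : ∀ x, inner ℂ x (T x) = ∑ i, L i (coeffPoly _ x * conjPoly (coeffPoly _ x)) :=
    fun x => by rw [inner_hankelCLM, LinearMap.sum_apply, mul_comm]
  obtain ⟨U, hfinrank, hU⟩ := h.exists_re_sum_apply_nonpos
  simp only [← hinner] at hU
  refine ⟨_, negEigenspace T, hfinrank.ge.trans (finrank_le_finrank_negEigenspace_of_nonpos hT
    (fun x => h.eq_zero_of_hankelCLM_eq_zero) hU), ?_⟩
  simp only [← hinner]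
  exact exists_re_inner_le_neg_mul_norm_sq
    fun x hx hx0 => inner_map_self_neg_of_mem_negEigenspace hT.isSymmetric hx hx0

theorem sum_apply_mul_of_dvd_one_sub (h : IsRealJetFamily β K c L) {e : ℂ[X]}
    (hdvd : nodePoly β (fun i => K i + 1) ∣ 1 - e) (he : conjPoly e = e) (p : ℂ[X]) :
    ∑ i, L i (e * p * conjPoly (e * p)) = ∑ i, L i (p * conjPoly p) := by
  have hsub : p * conjPoly p - e * p * conjPoly (e * p) =
      (1 - e) * ((1 + e) * (p * conjPoly p)) := by
    rw [conjPoly_mul, he]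
    ring
  rw [eq_comm, ← sub_eq_zero, ← Finset.sum_sub_distrib]
  simp only [← map_sub, hsub]
  exact h.sum_apply_eq_zero_of_dvd (hdvd.mul_right _)

theorem exists_sum_apply_add_integral_neg (h : IsRealJetFamily β K c L) :
    ∃ W : Submodule ℂ ℂ[X],
      ∑ i, negMultiplicity (β i) (K i) (c i) ≤ Module.finrank ℂ W ∧ ∀ u ∈ W, u ≠ 0 →
        (∑ i, L i (u * conjPoly u)).re + ∫ t in (-1 : ℝ)..1, ‖u.eval (t : ℂ)‖ ^ 2 < 0 := by
  obtain ⟨n, V, hfinrank, δ, hδ, hV⟩ := h.exists_re_sum_apply_le_neg_mul_norm_sq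
  obtain ⟨e, hdvd, he, hsmall⟩ := exists_dvd_one_sub_integral_norm_sq_lt
    (monic_nodePoly β fun i => K i + 1).ne_zero (-1) 1 (show 0 < δ / (n + 1) by positivity)
  have hneg : ∀ x ∈ V, x ≠ 0 → (∑ i, L i (e * coeffPoly n x * conjPoly (e * coeffPoly n x))).re +
      ∫ t in (-1 : ℝ)..1, ‖(e * coeffPoly n x).eval (t : ℂ)‖ ^ 2 < 0 := by
    intro x hx hx0
    have hnorm : 0 < ‖x‖ ^ 2 := by positivity
    calc _ ≤ -δ * ‖x‖ ^ 2 + (∫ t in (-1 : ℝ)..1, ‖e.eval (t : ℂ)‖ ^ 2) * (n * ‖x‖ ^ 2) :=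
          add_le_add ((h.sum_apply_mul_of_dvd_one_sub hdvd he _).symm ▸ hV x hx)
            (integral_norm_eval_mul_coeffPoly_sq_le e x)
      _ ≤ -δ * ‖x‖ ^ 2 + δ / (n + 1) * (n * ‖x‖ ^ 2) := by gcongr
      _ = -(δ / (n + 1) * ‖x‖ ^ 2) := by field_simp; ring
      _ < 0 := neg_neg_of_pos (mul_pos (by positivity) hnorm)
  set ψ : V →ₗ[ℂ] ℂ[X] := LinearMap.mulLeft ℂ e ∘ₗ coeffPoly n ∘ₗ V.subtype
  have hψ : Function.Injective ψ := (injective_iff_map_eq_zero ψ).2 fun x hx => by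
    by_contra hx0
    have hlt := hneg x x.2 (mt Submodule.coe_eq_zero.1 hx0)
    rw [show e * coeffPoly n x = 0 from hx] at hlt
    simp at hlt
  refine ⟨LinearMap.range ψ, ?_, ?_⟩
  · rwa [LinearMap.finrank_range_of_inj hψ]
  · rintro _ ⟨x, rfl⟩ hx0
    exact hneg x x.2 fun h0 => hx0 (by rw [Submodule.coe_eq_zero.1 h0, map_zero])

end IsRealJetFamily

section CircleIntegrals

/-- The point of the unit circle in `ℂ` with parameter `t`. -/
noncomputable def circleVal (t : UnitAddCircle) : ℂ := (AddCircle.toCircle t : ℂ)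

theorem norm_circleVal (t : UnitAddCircle) : ‖circleVal t‖ = 1 := Circle.norm_coe _

theorem circleVal_neg (t : UnitAddCircle) : circleVal (-t) = (starRingEnd ℂ) (circleVal t) := by
  rw [circleVal, AddCircle.toCircle_neg, Circle.coe_inv_eq_conj, circleVal]

theorem circleVal_mul_circleVal_neg (t : UnitAddCircle) : circleVal t * circleVal (-t) = 1 := by
  rw [circleVal_neg, Complex.mul_conj', norm_circleVal, Complex.ofReal_one, one_pow]

theorem circleVal_ne_zero (t : UnitAddCircle) : circleVal t ≠ 0 :=
  left_ne_zero_of_mul_eq_one (circleVal_mul_circleVal_neg t)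

@[fun_prop]
theorem continuous_circleVal : Continuous circleVal :=
  continuous_subtype_val.comp AddCircle.continuous_toCircle

theorem circleVal_coe (x : ℝ) :
    circleVal (x : UnitAddCircle) = circleMap 0 1 (2 * Real.pi * x) := by
  rw [circleVal, AddCircle.toCircle_apply_mk, Circle.coe_exp, circleMap_zero, div_one,
    Complex.ofReal_one, one_mul]

theorem integral_comp_circleVal_neg (φ : ℂ → ℂ) :
    ∫ t : UnitAddCircle, φ (circleVal (-t)) ∂AddCircle.haarAddCircle =
      Real.circleAverage φ 0 1 := by
  rw [integral_neg_eq_self fun t : UnitAddCircle => φ (circleVal t),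
    AddCircle.integral_haarAddCircle, ← AddCircle.intervalIntegral_preimage 1 0,
    Real.circleAverage_def]
  simp only [circleVal_coe, zero_add, inv_one, one_smul]
  rw [intervalIntegral.integral_comp_mul_left (fun θ => φ (circleMap 0 1 θ))
    Real.two_pi_pos.ne', mul_zero, mul_one]

theorem integral_div_sub_mul_eval {b : ℂ} (hb : ‖b‖ < 1) (f : ℂ[X]) :
    ∫ t : UnitAddCircle, circleVal (-t) / (circleVal (-t) - b) * f.eval (circleVal (-t))
      ∂AddCircle.haarAddCircle = f.eval b := by
  have hcauchy := DiffContOnCl.circleAverage_smul_div (c := 0) (R := 1) (w := b)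
    (f.differentiable.diffContOnCl (s := Metric.ball 0 |1|)) (by simpa using hb)
  simp only [sub_zero, smul_eq_mul] at hcauchy
  rw [← hcauchy]
  exact integral_comp_circleVal_neg fun w => w / (w - b) * f.eval w

theorem integral_eval_circleVal_neg (f : ℂ[X]) :
    ∫ t : UnitAddCircle, f.eval (circleVal (-t)) ∂AddCircle.haarAddCircle = f.eval 0 := by
  rw [← integral_div_sub_mul_eval (b := 0) (by simp)]
  congr 1
  ext t
  rw [sub_zero, div_self (circleVal_ne_zero _), one_mul]

theorem eval_mul_pow_of_mul_eq_one {R : ℂ[X]} {n : ℕ} (hR : R.natDegree ≤ n) {z w : ℂ}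
    (hzw : z * w = 1) : R.eval z * w ^ n = (R.reflect n).eval w := by
  let : Invertible z := invertibleOfRightInverse z w hzw
  have hreflect := eval₂_reflect_mul_pow (RingHom.id ℂ) z n R hR
  rw [eval₂_id, eval₂_id, invOf_eq_right_inv hzw] at hreflect
  rw [← hreflect, mul_assoc, ← mul_pow, hzw, one_pow, mul_one]

theorem integrable_haarAddCircle {s : UnitAddCircle → ℂ} (hs : Continuous s) :
    Integrable s AddCircle.haarAddCircle :=
  hs.integrable_of_hasCompactSupport (HasCompactSupport.of_compactSpace s)

@[fun_prop]
theorem continuous_eval_circleVal_neg (f : ℂ[X]) :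
    Continuous fun t : UnitAddCircle => f.eval (circleVal (-t)) :=
  f.continuous.comp (by fun_prop)

/-- The pairing `(s, f) ↦ ∫ s(μ) f(μ̄) dm(μ)` of continuous symbols with polynomials. -/
noncomputable def circleFunctional : C(UnitAddCircle, ℂ) →ₗ[ℂ] ℂ[X] →ₗ[ℂ] ℂ :=
  LinearMap.mk₂ ℂ
    (fun s f => ∫ t : UnitAddCircle, s t * f.eval (circleVal (-t)) ∂AddCircle.haarAddCircle)
    (fun s s' f => by
      simp only [ContinuousMap.add_apply, add_mul]
      exact integral_add (integrable_haarAddCircle (by fun_prop))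
        (integrable_haarAddCircle (by fun_prop)))
    (fun a s f => by
      simp only [ContinuousMap.smul_apply, smul_eq_mul, mul_assoc, integral_const_mul])
    (fun s f f' => by
      simp only [eval_add, mul_add]
      exact integral_add (integrable_haarAddCircle (by fun_prop))
        (integrable_haarAddCircle (by fun_prop)))
    (fun a s f => by
      simp only [eval_smul, smul_eq_mul, mul_left_comm, integral_const_mul])

theorem circleFunctional_apply (s : C(UnitAddCircle, ℂ)) (f : ℂ[X]) :
    circleFunctional s f =
      ∫ t : UnitAddCircle, s t * f.eval (circleVal (-t)) ∂AddCircle.haarAddCircle :=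
  rfl

/-- The restriction of a polynomial to the unit circle. -/
noncomputable def polySymbol (R : ℂ[X]) : C(UnitAddCircle, ℂ) where
  toFun t := R.eval (circleVal t)
  continuous_toFun := R.continuous.comp continuous_circleVal

/-- The restriction of `R(ζ) (ζ - γ) ^ (-k-1)` to the unit circle. -/
noncomputable def poleSymbol {γ : ℂ} (hγ : 1 < ‖γ‖) (k : ℕ) (R : ℂ[X]) :
    C(UnitAddCircle, ℂ) where
  toFun t := R.eval (circleVal t) / (circleVal t - γ) ^ (k + 1)
  continuous_toFun := by
    refine (R.continuous.comp continuous_circleVal).div (by fun_prop) fun t =>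
      pow_ne_zero _ (sub_ne_zero.2 fun h => hγ.ne ?_)
    rw [← h, norm_circleVal]

theorem isJet_circleFunctional_polySymbol {R : ℂ[X]} (hR : R ≠ 0) :
    IsJet 0 R.natDegree R.leadingCoeff (circleFunctional (polySymbol R)) where
  coeff_ne_zero := leadingCoeff_ne_zero.2 hR
  apply_pow_mul f := by
    set n := R.natDegree
    calc circleFunctional (polySymbol R) ((X - C 0) ^ n * f)
        = ∫ t : UnitAddCircle, (R.reflect n * f).eval (circleVal (-t))
            ∂AddCircle.haarAddCircle := by
          rw [circleFunctional_apply]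
          congr 1
          ext t
          rw [eval_mul, eval_mul, ← eval_mul_pow_of_mul_eq_one le_rfl
            (circleVal_mul_circleVal_neg t), C_0, sub_zero, eval_pow, eval_X, mul_assoc]
          rfl
      _ = R.leadingCoeff * f.eval 0 := by
          rw [integral_eval_circleVal_neg, eval_mul, ← coeff_zero_eq_eval_zero,
            coeff_reflect, revAt_zero, leadingCoeff]

/-- The top coefficient of the jet at `γ⁻¹` defined by the symbol `R(ζ) (ζ - γ) ^ (-k-1)`. -/
noncomputable def poleCoeff (γ : ℂ) (k : ℕ) (R : ℂ[X]) : ℂ :=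
  (-γ⁻¹) ^ (k + 1) * (R.eval γ * γ⁻¹ ^ k)

theorem isJet_circleFunctional_poleSymbol {γ : ℂ} (hγ : 1 < ‖γ‖) {k : ℕ} {R : ℂ[X]}
    (hdeg : R.natDegree ≤ k) (hR : R.eval γ ≠ 0) :
    IsJet γ⁻¹ k (poleCoeff γ k R) (circleFunctional (poleSymbol hγ k R)) := by
  have hγ0 : γ ≠ 0 := norm_pos_iff.1 (one_pos.trans hγ)
  have hb : ‖γ⁻¹‖ < 1 := norm_inv γ ▸ inv_lt_one_of_one_lt₀ hγ
  refine ⟨by simp [poleCoeff, hγ0, hR], fun f => ?_⟩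
  have hw : ∀ t, circleVal (-t) - γ⁻¹ ≠ 0 := fun t =>
    sub_ne_zero.2 fun h => hb.ne (h ▸ norm_circleVal _)
  -- With `w = μ⁻¹`, the pole at `μ = γ` becomes one at `w = γ⁻¹`, where Cauchy's
  -- formula applies.
  have hinv : ∀ t, (circleVal t - γ)⁻¹ =
      -γ⁻¹ * (circleVal (-t) / (circleVal (-t) - γ⁻¹)) := fun t => by
    refine inv_eq_of_mul_eq_one_right ?_
    rw [mul_div_assoc', mul_div_assoc', div_eq_one_iff_eq (hw t)]
    linear_combination (-γ⁻¹) * circleVal_mul_circleVal_neg t +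
      circleVal (-t) * mul_inv_cancel₀ hγ0
  calc circleFunctional (poleSymbol hγ k R) ((X - C γ⁻¹) ^ k * f)
      = (-γ⁻¹) ^ (k + 1) * ∫ t : UnitAddCircle, circleVal (-t) / (circleVal (-t) - γ⁻¹) *
          (R.reflect k * f).eval (circleVal (-t)) ∂AddCircle.haarAddCircle := by
        rw [circleFunctional_apply, ← integral_const_mul]
        congr 1
        ext t
        change R.eval (circleVal t) / (circleVal t - γ) ^ (k + 1) * _ = _
        rw [div_eq_mul_inv, ← inv_pow, hinv]
        simp only [eval_mul, eval_pow, eval_sub, eval_X, eval_C,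
          ← eval_mul_pow_of_mul_eq_one hdeg (circleVal_mul_circleVal_neg t)]
        rw [mul_pow, div_pow]
        generalize circleVal (-t) - γ⁻¹ = d, hw t = hd, -γ⁻¹ = a
        field_simp
        ring
    _ = poleCoeff γ k R * f.eval γ⁻¹ := by
        rw [integral_div_sub_mul_eval hb, eval_mul,
          ← eval_mul_pow_of_mul_eq_one hdeg (mul_inv_cancel₀ hγ0), poleCoeff]
        ring

end CircleIntegrals

section Carleman

theorem exists_derivative_eq (f : ℂ[X]) : ∃ F : ℂ[X], derivative F = f := by
  induction f using Polynomial.induction_on' with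
  | add p q hp hq =>
    obtain ⟨P, rfl⟩ := hp
    obtain ⟨Q, rfl⟩ := hq
    exact ⟨P + Q, derivative_add⟩
  | monomial k a =>
    refine ⟨monomial (k + 1) (a / (k + 1)), ?_⟩
    rw [derivative_monomial_succ, div_mul_cancel₀ a k.cast_add_one_ne_zero]

theorem hasDerivAt_eval_circleMap (F : ℂ[X]) (θ : ℝ) :
    HasDerivAt (fun θ : ℝ => F.eval (circleMap 0 1 θ))
      ((derivative F).eval (circleMap 0 1 θ) * (circleMap 0 1 θ * Complex.I)) θ :=
  (F.hasDerivAt _).comp θ (hasDerivAt_circleMap 0 1 θ)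

theorem integral_eval_derivative_ofReal (F : ℂ[X]) (a b : ℝ) :
    ∫ x in a..b, (derivative F).eval (x : ℂ) = F.eval (b : ℂ) - F.eval (a : ℂ) :=
  intervalIntegral.integral_eq_sub_of_hasDerivAt (fun _ _ => (F.hasDerivAt _).comp_ofReal)
    ((continuous_eval_ofReal _).intervalIntegrable _ _)

theorem integral_eqOn_eval_derivative_circleMap {F : ℂ[X]} {φ : ℝ → ℂ} {a b : ℝ} (hab : a ≤ b)
    {s : ℂ} (hφ : Set.EqOn φ (fun θ => s * ((derivative F).eval (circleMap 0 1 θ) *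
      (circleMap 0 1 θ * Complex.I))) (Set.Ioo a b)) :
    IntervalIntegrable φ volume a b ∧
      ∫ θ in a..b, φ θ = s * (F.eval (circleMap 0 1 b) - F.eval (circleMap 0 1 a)) := by
  have hcont : Continuous fun θ : ℝ =>
      (derivative F).eval (circleMap 0 1 θ) * (circleMap 0 1 θ * Complex.I) := by fun_prop
  constructor
  · exact (intervalIntegrable_congr_uIoo (Set.uIoo_of_le hab ▸ hφ)).2
      ((hcont.const_mul s).intervalIntegrable _ _)
  · rw [intervalIntegral.integral_congr_Ioo_of_le hab hφ, intervalIntegral.integral_const_mul,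
      intervalIntegral.integral_eq_sub_of_hasDerivAt
        (fun θ _ => hasDerivAt_eval_circleMap F θ) (hcont.intervalIntegrable _ _)]

theorem carlemanSymbol_toCircle (t : UnitAddCircle) :
    carlemanSymbol (AddCircle.toCircle t) =
      -(Real.pi * (circleVal (-t) * Complex.I)) * Real.sign (circleVal (-t)).im := by
  have hinv : (AddCircle.toCircle t : ℂ)⁻¹ = circleVal (-t) :=
    inv_eq_of_mul_eq_one_right (circleVal_mul_circleVal_neg t)
  rw [carlemanSymbol, hinv, circleVal_neg, Complex.conj_im, Real.sign_neg]
  simp only [circleVal]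
  push_cast
  ring

theorem integral_carlemanSymbol_mul_eval (f : ℂ[X]) :
    ∫ t : UnitAddCircle, carlemanSymbol (AddCircle.toCircle t) * f.eval (circleVal (-t))
      ∂AddCircle.haarAddCircle = ∫ x in (-1 : ℝ)..1, f.eval (x : ℂ) := by
  obtain ⟨F, rfl⟩ := exists_derivative_eq f
  set φ : ℂ → ℂ := fun w =>
    -(Real.pi * (w * Complex.I)) * Real.sign w.im * (derivative F).eval w
  have him : ∀ θ, (circleMap 0 1 θ).im = Real.sin θ := fun θ => by
    rw [circleMap_zero, Complex.ofReal_one, one_mul, Complex.exp_ofReal_mul_I_im]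
  obtain ⟨hint_upper, hupper⟩ := integral_eqOn_eval_derivative_circleMap (F := F)
    (φ := fun θ => φ (circleMap 0 1 θ)) (s := -Real.pi) Real.pi_pos.le fun θ hθ => by
      simp only [φ]
      rw [him, Real.sign_of_pos (Real.sin_pos_of_mem_Ioo hθ), Complex.ofReal_one]
      ring
  obtain ⟨hint_lower, hlower⟩ := integral_eqOn_eval_derivative_circleMap (F := F)
    (φ := fun θ => φ (circleMap 0 1 θ)) (a := Real.pi) (b := 2 * Real.pi) (s := Real.pi)
    (by linarith [Real.pi_pos]) fun θ hθ => by
      have hsin : Real.sin θ < 0 := by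
        rw [← Real.sin_sub_two_pi]
        exact Real.sin_neg_of_neg_of_neg_pi_lt (by linarith [hθ.2]) (by linarith [hθ.1])
      simp only [φ]
      rw [him, Real.sign_of_neg hsin, Complex.ofReal_neg, Complex.ofReal_one]
      ring
  simp only [carlemanSymbol_toCircle]
  rw [integral_comp_circleVal_neg φ, Real.circleAverage_def,
    ← intervalIntegral.integral_add_adjacent_intervals hint_upper hint_lower, hupper, hlower,
    integral_eval_derivative_ofReal]
  have hpi : (Real.pi : ℂ) ≠ 0 := Complex.ofReal_ne_zero.2 Real.pi_ne_zero
  simp only [circleMap_zero, Complex.ofReal_one, Complex.ofReal_neg, Complex.ofReal_mul,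
    Complex.ofReal_ofNat, Complex.ofReal_zero, one_mul, zero_mul, Complex.exp_pi_mul_I,
    Complex.exp_two_pi_mul_I, Complex.exp_zero, Complex.real_smul, Complex.ofReal_inv]
  field_simp
  ring

end Carleman

section SignCount

theorem map_conjPoly_of_im_eq_zero {Λ : ℂ[X] →ₗ[ℂ] ℂ}
    (h : ∀ u : ℂ[X], (Λ (u * conjPoly u)).im = 0) (f : ℂ[X]) :
    Λ (conjPoly f) = (starRingEnd ℂ) (Λ f) := by
  have hone : conjPoly (1 : ℂ[X]) = 1 := Polynomial.map_one _
  have hI : conjPoly (C Complex.I) = -C Complex.I := by simp [conjPoly]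
  have hΛone : (Λ 1).im = 0 := by simpa [hone] using h 1
  have him : (Λ f).im + (Λ (conjPoly f)).im = 0 := by
    have hexpand : (f + 1) * conjPoly (f + 1) = f * conjPoly f + f + conjPoly f + 1 := by
      rw [conjPoly_add, hone]
      ring
    have := h (f + 1)
    rw [hexpand] at this
    simpa [h f, hΛone] using this
  have hre : (Λ (conjPoly f)).re = (Λ f).re := by
    have hexpand : (f + C Complex.I) * conjPoly (f + C Complex.I) =
        f * conjPoly f + Complex.I • conjPoly f - Complex.I • f + 1 := by
      have hII : (C Complex.I * C Complex.I : ℂ[X]) = -1 := by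
        rw [← C_mul, Complex.I_mul_I, C_neg, C_1]
      rw [conjPoly_add, hI, smul_eq_C_mul, smul_eq_C_mul]
      linear_combination -hII
    have := h (f + C Complex.I)
    rw [hexpand] at this
    simpa [h f, hΛone, sub_eq_zero] using this
  exact Complex.ext hre (by rw [Complex.conj_im]; linarith)

theorem range_mulLeft_sup_degreeLT {p : ℂ[X]} (hp : p.Monic) :
    LinearMap.range (LinearMap.mulLeft ℂ p) ⊔ degreeLT ℂ p.natDegree = ⊤ := by
  refine eq_top_iff.2 fun u _ => ?_
  rw [← modByMonic_add_div u p, add_comm]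
  refine Submodule.add_mem_sup ⟨u /ₘ p, rfl⟩ ?_
  rw [mem_degreeLT, ← degree_eq_natDegree hp.ne_zero]
  exact degree_modByMonic_lt u hp

theorem finrank_map_degreeLT_le {V : Type*} [AddCommGroup V] [Module ℂ V] (J : ℂ[X] →ₗ[ℂ] V)
    (N : ℕ) : Module.finrank ℂ ((degreeLT ℂ N).map J) ≤ N := by
  have := Module.Finite.equiv (degreeLTEquiv ℂ N).symm
  refine (Submodule.finrank_map_le _ _).trans ?_
  rw [(degreeLTEquiv ℂ N).finrank_eq, Module.finrank_fin_fun]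

variable {ι : Type*} [Fintype ι] {β : ι → ℂ} {K : ι → ℕ} {c : ι → ℂ} {L : ι → ℂ[X] →ₗ[ℂ] ℂ}

theorem rank_negEigenspace_of_inner_eq {H : Type*} [NormedAddCommGroup H]
    [InnerProductSpace ℂ H] [CompleteSpace H] {J : ℂ[X] →ₗ[ℂ] H} (hJ : (LinearMap.range J)ᗮ = ⊥)
    {G : H →L[ℂ] H} (hG : IsSelfAdjoint G)
    (hβ : Function.Injective β) (hL : ∀ i, IsJet (β i) (K i) (c i) (L i))
    (hinner : ∀ u, inner ℂ (J u) (G (J u)) =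
      ∑ i, L i (u * conjPoly u) + (∫ x in (-1 : ℝ)..1, ‖u.eval (x : ℂ)‖ ^ 2 : ℝ)) :
    (∀ t : ℝ, t < 0 → (t : ℂ) ∈ spectrum ℂ G →
      Module.End.HasEigenvalue (G : H →ₗ[ℂ] H) (t : ℂ)) ∧
    Module.rank ℂ (negEigenspace G) =
      (∑ i, negMultiplicity (β i) (K i) (c i) : ℕ) := by
  have h : IsRealJetFamily β K c L := ⟨hβ, hL, fun f => by
    have him : ∀ u, ((∑ i, L i) (u * conjPoly u)).im = 0 := fun u => by
      have := hG.isSymmetric.im_inner_self_apply (J u)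
      simpa [hinner] using this
    simpa only [LinearMap.sum_apply] using map_conjPoly_of_im_eq_zero him f⟩
  have hre : ∀ u, (inner ℂ (J u) (G (J u))).re =
      (∑ i, L i (u * conjPoly u)).re + ∫ x in (-1 : ℝ)..1, ‖u.eval (x : ℂ)‖ ^ 2 := fun u => by
    rw [hinner, Complex.add_re, Complex.ofReal_re]
  obtain ⟨W, hfinrank, hW⟩ := h.exists_sum_apply_add_integral_neg
  simp only [← hre] at hW
  set p := nodePoly β fun i => negMultiplicity (β i) (K i) (c i)
  set ψ : W →ₗ[ℂ] H := J ∘ₗ W.subtype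
  have hψ : Function.Injective ψ := (injective_iff_map_eq_zero ψ).2 fun u hu => by
    by_contra hu0
    have hlt := hW u u.2 (mt Submodule.coe_eq_zero.1 hu0)
    rw [show J u = 0 from hu, inner_zero_left, Complex.zero_re] at hlt
    exact hlt.false
  have : FiniteDimensional ℂ (degreeLT ℂ p.natDegree) :=
    Module.Finite.equiv (degreeLTEquiv ℂ _).symm
  refine rank_negEigenspace_of_dense_sup hG (W := LinearMap.range ψ)
    (D := (LinearMap.range (LinearMap.mulLeft ℂ p)).map J) (F := (degreeLT ℂ p.natDegree).map J)
    ?_ ?_ ?_ ((finrank_map_degreeLT_le J _).trans_eq (natDegree_nodePoly β _)) ?_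
  · rw [← Submodule.map_sup, range_mulLeft_sup_degreeLT (monic_nodePoly β _), Submodule.map_top, hJ]
  · rintro _ ⟨_, ⟨v, rfl⟩, rfl⟩
    rw [hre]
    exact add_nonneg
      (h.re_sum_apply_mul_conjPoly_nonneg_of_negMultiplicity (dvd_mul_right p v))
      (intervalIntegral.integral_nonneg (by norm_num) fun _ _ => by positivity)
  · rintro _ ⟨u, rfl⟩ hu
    exact hW u u.2 fun hu0 => hu (by rw [Submodule.coe_eq_zero.1 hu0, map_zero])
  · rwa [LinearMap.finrank_range_of_inj hψ]

end SignCount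

section HardyPolynomials

theorem fourier_one_pow (k : ℕ) : fourier (T := (1 : ℝ)) 1 ^ k = fourier (k : ℤ) := by
  ext t
  rw [ContinuousMap.pow_apply, fourier_apply, fourier_apply, one_zsmul, natCast_zsmul,
    AddCircle.toCircle_nsmul, Circle.coe_pow]

theorem fourierLp_mem_hardySpace (k : ℕ) :
    (fourierLp 2 (k : ℤ) : Lp ℂ 2 (AddCircle.haarAddCircle : Measure UnitAddCircle)) ∈
      hardySpace := by
  intro n hn
  rw [← fourierBasis_repr, ← coe_fourierBasis, HilbertBasis.repr_self]
  exact lp.single_apply_ne (E := fun _ : ℤ => ℂ) 2 _ _ (by omega)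

theorem toLp_aeval_mem_hardySpace (p : ℂ[X]) :
    ContinuousMap.toLp (E := ℂ) 2 AddCircle.haarAddCircle ℂ
      (aeval (fourier (T := (1 : ℝ)) 1) p) ∈ hardySpace := by
  induction p using Polynomial.induction_on' with
  | add p q hp hq =>
    rw [map_add, map_add]
    exact hardySpace.add_mem hp hq
  | monomial k a =>
    rw [aeval_monomial, fourier_one_pow, ← Algebra.smul_def, map_smul]
    exact hardySpace.smul_mem _ (fourierLp_mem_hardySpace k)

/-- The polynomials as elements of the Hardy space. -/
noncomputable def polyToHardy : ℂ[X] →ₗ[ℂ] hardySpace :=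
  LinearMap.codRestrict hardySpace
    ((ContinuousMap.toLp (E := ℂ) 2 (AddCircle.haarAddCircle (T := (1 : ℝ))) ℂ).toLinearMap ∘ₗ
      (aeval (fourier (T := (1 : ℝ)) 1)).toLinearMap) toLp_aeval_mem_hardySpace

theorem coe_polyToHardy (p : ℂ[X]) :
    (polyToHardy p : Lp ℂ 2 (AddCircle.haarAddCircle : Measure UnitAddCircle)) =
      ContinuousMap.toLp (E := ℂ) 2 AddCircle.haarAddCircle ℂ
        (aeval (fourier (T := (1 : ℝ)) 1) p) :=
  rfl

theorem coeFn_polyToHardy (p : ℂ[X]) :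
    ((polyToHardy p : Lp ℂ 2 (AddCircle.haarAddCircle : Measure UnitAddCircle)) :
      UnitAddCircle → ℂ) =ᵐ[AddCircle.haarAddCircle] fun t => p.eval (circleVal t) := by
  filter_upwards [ContinuousMap.coeFn_toLp (E := ℂ) (p := 2) (𝕜 := ℂ)
    (AddCircle.haarAddCircle (T := (1 : ℝ))) (aeval (fourier (T := (1 : ℝ)) 1) p)] with t ht
  rw [coe_polyToHardy, ht, aeval_continuousMap_apply, fourier_one]
  rfl

theorem range_polyToHardy_orthogonal : (LinearMap.range polyToHardy)ᗮ = ⊥ := by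
  refine (Submodule.eq_bot_iff _).2 fun v hv => Subtype.ext ?_
  refine (LinearIsometryEquiv.map_eq_zero_iff fourierBasis.repr).1 ?_
  ext n
  rw [lp.coeFn_zero, Pi.zero_apply]
  rcases lt_or_ge n 0 with hn | hn
  · rw [fourierBasis_repr]
    exact v.2 n hn
  · lift n to ℕ using hn
    have hbasis : fourierBasis (T := (1 : ℝ)) (n : ℤ) = polyToHardy (X ^ n) := by
      rw [coe_fourierBasis, coe_polyToHardy, map_pow, aeval_X, fourier_one_pow]
    rw [HilbertBasis.repr_apply_apply, hbasis]
    exact hv _ ⟨X ^ n, rfl⟩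

namespace IsHankelOperator

theorem inner_polyToHardy {G : hardySpace →L[ℂ] hardySpace} {σ : Circle → ℂ}
    (hG : IsHankelOperator G σ) (u : ℂ[X]) :
    inner ℂ (polyToHardy u) (G (polyToHardy u)) =
      ∫ t : UnitAddCircle, σ (AddCircle.toCircle t) * (u * conjPoly u).eval (circleVal (-t))
        ∂AddCircle.haarAddCircle := by
  rw [hG.inner_eq]
  have hu := coeFn_polyToHardy u
  have hu_neg := (Measure.measurePreserving_neg
    (AddCircle.haarAddCircle (T := (1 : ℝ)))).quasiMeasurePreserving.ae_eq_comp hu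
  refine integral_congr_ae ?_
  filter_upwards [hu, hu_neg] with t ht ht_neg
  simp only [Function.comp_apply] at ht_neg
  rw [ht, ht_neg, eval_mul, circleVal_neg, eval_conj_conjPoly, mul_assoc]

theorem inner_polyToHardy_carlemanSymbol_add {G : hardySpace →L[ℂ] hardySpace} {r : Circle → ℂ}
    {s : C(UnitAddCircle, ℂ)} (hG : IsHankelOperator G fun μ => carlemanSymbol μ + r μ)
    (hr : ∀ t, r (AddCircle.toCircle t) = s t) (u : ℂ[X]) :
    inner ℂ (polyToHardy u) (G (polyToHardy u)) =
      circleFunctional s (u * conjPoly u) +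
        (∫ x in (-1 : ℝ)..1, ‖u.eval (x : ℂ)‖ ^ 2 : ℝ) := by
  set f := u * conjPoly u
  have hs : Integrable s AddCircle.haarAddCircle := integrable_haarAddCircle s.continuous
  have hcarleman : Integrable (fun t : UnitAddCircle => carlemanSymbol (AddCircle.toCircle t))
      AddCircle.haarAddCircle := by
    refine ((hG.memLp_symbol.integrable le_top).sub hs).congr
      (Filter.Eventually.of_forall fun t => ?_)
    simp [hr]
  have hmul : ∀ {g : UnitAddCircle → ℂ}, Integrable g AddCircle.haarAddCircle →
      Integrable (fun t => g t * f.eval (circleVal (-t))) AddCircle.haarAddCircle := fun hg => by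
    have hf := continuous_eval_circleVal_neg f
    obtain ⟨B, hB⟩ := isCompact_univ.exists_bound_of_continuousOn hf.continuousOn
    exact hg.mul_bdd hf.aestronglyMeasurable
      (Filter.Eventually.of_forall fun t => hB t (Set.mem_univ t))
  have hsquare : ∫ x in (-1 : ℝ)..1, f.eval (x : ℂ) =
      (∫ x in (-1 : ℝ)..1, ‖u.eval (x : ℂ)‖ ^ 2 : ℝ) := by
    rw [← intervalIntegral.integral_ofReal]
    exact congrArg (intervalIntegral · _ _ _) (funext fun x =>
      eval_mul_conjPoly_of_im_eq_zero u (Complex.ofReal_im x))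
  rw [hG.inner_polyToHardy, ← hsquare, ← integral_carlemanSymbol_mul_eval, circleFunctional_apply,
    add_comm, ← integral_add (hmul hcarleman) (hmul hs)]
  simp only [hr, add_mul, f]

theorem rank_negEigenspace_of_isJet {ι : Type*} [Fintype ι] {β : ι → ℂ} {K : ι → ℕ} {c : ι → ℂ}
    {s : ι → C(UnitAddCircle, ℂ)} {r : Circle → ℂ} {G : hardySpace →L[ℂ] hardySpace}
    (hG : IsHankelOperator G fun μ => carlemanSymbol μ + r μ) (hG_sa : IsSelfAdjoint G)
    (hβ : Function.Injective β)
    (hs : ∀ i, IsJet (β i) (K i) (c i) (circleFunctional (s i)))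
    (hr : ∀ t, r (AddCircle.toCircle t) = (∑ i, s i) t) :
    (∀ t : ℝ, t < 0 → (t : ℂ) ∈ spectrum ℂ G →
      Module.End.HasEigenvalue (G : hardySpace →ₗ[ℂ] hardySpace) (t : ℂ)) ∧
    Module.rank ℂ (negEigenspace G) =
      (∑ i, negMultiplicity (β i) (K i) (c i) : ℕ) :=
  rank_negEigenspace_of_inner_eq range_polyToHardy_orthogonal hG_sa hβ hs fun u => by
    rw [hG.inner_polyToHardy_carlemanSymbol_add hr, map_sum, LinearMap.sum_apply]

end IsHankelOperator

end HardyPolynomials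

section RationalSymbol

theorem negCount_congr {k : ℕ} {p p' : ℝ} (h : Even k → (0 < p ↔ 0 < p')) :
    negCount k p = negCount k p' := by
  unfold negCount
  by_cases hk : Odd k
  · rw [if_pos hk, if_pos hk]
  · rw [if_neg hk, if_neg hk]
    exact if_congr (h (Nat.not_odd_iff_even.1 hk)) rfl rfl

theorem negMultiplicity_leadingCoeff (R : ℂ[X]) :
    negMultiplicity 0 R.natDegree R.leadingCoeff =
      negCount R.natDegree ((derivative^[R.natDegree] R).eval 0).re := by
  rw [negMultiplicity, if_pos Complex.zero_im]
  refine negCount_congr fun _ => ?_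
  rw [← coeff_zero_eq_eval_zero, coeff_iterate_derivative, zero_add, nsmul_eq_mul,
    Nat.descFactorial_self, ← Complex.ofReal_natCast, Complex.re_ofReal_mul]
  exact (mul_pos_iff_of_pos_left (by exact_mod_cast Nat.factorial_pos _)).symm

theorem inv_eq_inv_abs_mul_sign (x : ℝ) : x⁻¹ = |x|⁻¹ * Real.sign x := by
  rcases lt_trichotomy x 0 with hx | rfl | hx
  · rw [Real.sign_of_neg hx, abs_of_neg hx, inv_neg, mul_neg_one, neg_neg]
  · rw [inv_zero, Real.sign_zero, mul_zero]
  · rw [Real.sign_of_pos hx, abs_of_pos hx, mul_one]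

theorem negCount_poleCoeff {γ : ℂ} (hreal : γ.im = 0) (hγ : γ ≠ 0) (k : ℕ) (R : ℂ[X]) :
    negCount k (poleCoeff γ k R).re = negCount k (-(R.eval γ).re * Real.sign γ.re) := by
  obtain ⟨g, rfl⟩ : ∃ g : ℝ, γ = g := ⟨γ.re, Complex.ext rfl hreal⟩
  have hg : g ≠ 0 := Complex.ofReal_ne_zero.1 hγ
  refine negCount_congr fun hk => ?_
  have hcoeff : poleCoeff g k R =
      (((g ^ 2)⁻¹ ^ k * |g|⁻¹ : ℝ) : ℂ) * ((Real.sign g : ℝ) * -R.eval (g : ℂ)) := by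
    have hsign : (g : ℂ)⁻¹ = ((|g|⁻¹ : ℝ) : ℂ) * Real.sign g := by
      exact_mod_cast inv_eq_inv_abs_mul_sign g
    rw [poleCoeff, pow_succ, hk.neg_pow]
    push_cast at hsign ⊢
    linear_combination -((g : ℂ)⁻¹ ^ k * (g : ℂ)⁻¹ ^ k * R.eval (g : ℂ)) * hsign
  rw [hcoeff, Complex.re_ofReal_mul, mul_pos_iff_of_pos_left (by positivity),
    Complex.re_ofReal_mul, Complex.neg_re, Complex.ofReal_re, mul_comm]

theorem negMultiplicity_poleCoeff {γ : ℂ} (hγ : γ ≠ 0) (k : ℕ) (R : ℂ[X]) :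
    negMultiplicity γ⁻¹ k (poleCoeff γ k R) =
      if γ.im = 0 then negCount k (-(R.eval γ).re * Real.sign γ.re)
      else if γ.im < 0 then k + 1 else 0 := by
  have hnormSq : 0 < Complex.normSq γ := Complex.normSq_pos.2 hγ
  have him : γ⁻¹.im = 0 ↔ γ.im = 0 := by
    rw [Complex.inv_im, div_eq_zero_iff, neg_eq_zero, or_iff_left hnormSq.ne']
  have hpos : 0 < γ⁻¹.im ↔ γ.im < 0 := by
    rw [Complex.inv_im, div_pos_iff_of_pos_right hnormSq, neg_pos]
  simp only [negMultiplicity, him, hpos]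
  split_ifs with hreal
  exacts [negCount_poleCoeff hreal hγ k R, rfl, rfl]

theorem sum_negMultiplicity_poleCoeff {ι : Type*} [Fintype ι] {γ : ι → ℂ} (hγ : ∀ m, γ m ≠ 0)
    (K : ι → ℕ) (R : ι → ℂ[X]) :
    ∑ m, negMultiplicity (γ m)⁻¹ (K m) (poleCoeff (γ m) (K m) (R m)) =
      ∑ m with (γ m).im = 0, negCount (K m) (-((R m).eval (γ m)).re * Real.sign (γ m).re) +
        ∑ m with (γ m).im < 0, K m + (Finset.univ.filter fun m => (γ m).im < 0).card := by
  rw [Finset.sum_filter, Finset.sum_filter, Finset.card_filter, ← Finset.sum_add_distrib,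
    ← Finset.sum_add_distrib]
  refine Finset.sum_congr rfl fun m _ => ?_
  rw [negMultiplicity_poleCoeff (hγ m)]
  by_cases hreal : (γ m).im = 0
  · simp [hreal]
  · by_cases hneg : (γ m).im < 0 <;> simp [hreal, hneg]

theorem rationalSymbol_toCircle (R₁ : ℂ[X]) {n : ℕ} {γ : Fin n → ℂ} (hγ : ∀ m, 1 < ‖γ m‖)
    (K : Fin n → ℕ) (R : Fin n → ℂ[X]) (t : UnitAddCircle) :
    rationalSymbol R₁ γ K R (AddCircle.toCircle t) =
      (polySymbol R₁ + ∑ m, poleSymbol (hγ m) (K m) (R m)) t := by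
  rw [ContinuousMap.add_apply, ContinuousMap.sum_apply]
  rfl

theorem polySymbol_zero : polySymbol 0 = 0 :=
  ContinuousMap.ext fun _ => eval_zero

end RationalSymbol

theorem theorem5p4 (R₁ : Polynomial ℂ) (n : ℕ) (γ : Fin n → ℂ) (K : Fin n → ℕ)
    (R : Fin n → Polynomial ℂ)
    (hγ_inj : Function.Injective γ)
    (hγ : ∀ m, 1 < ‖γ m‖)
    (hR_deg : ∀ m, (R m).natDegree ≤ K m)
    (hR_ne : ∀ m, (R m).eval (γ m) ≠ 0)
    (G : hardySpace →L[ℂ] hardySpace)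
    (hG : IsHankelOperator G fun μ => carlemanSymbol μ + rationalSymbol R₁ γ K R (μ : ℂ))
    (hG_sa : IsSelfAdjoint G) :
    (∀ t : ℝ, t < 0 → (t : ℂ) ∈ spectrum ℂ G →
      Module.End.HasEigenvalue (G : hardySpace →ₗ[ℂ] hardySpace) (t : ℂ)) ∧
    Module.rank ℂ (negEigenspace G) =
      (((if R₁ = 0 then 0 else
            negCount R₁.natDegree ((Polynomial.derivative^[R₁.natDegree] R₁).eval 0).re) +
          ∑ m with (γ m).im = 0,
            negCount (K m) (-((R m).eval (γ m)).re * Real.sign (γ m).re) +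
          ∑ m with (γ m).im < 0, K m +
          (Finset.univ.filter fun m => (γ m).im < 0).card : ℕ) : Cardinal) := by
  have hγ_ne : ∀ m, γ m ≠ 0 := fun m => norm_pos_iff.1 (one_pos.trans (hγ m))
  have hβ : Function.Injective fun m => (γ m)⁻¹ := inv_injective.comp hγ_inj
  have hpole := fun m => isJet_circleFunctional_poleSymbol (hγ m) (hR_deg m) (hR_ne m)
  have hr := rationalSymbol_toCircle R₁ hγ K R
  rw [add_assoc, add_assoc, ← add_assoc (∑ m with _, _),
    ← sum_negMultiplicity_poleCoeff hγ_ne K R]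
  by_cases hR₁ : R₁ = 0
  · rw [if_pos hR₁, zero_add]
    exact hG.rank_negEigenspace_of_isJet hG_sa hβ hpole fun t => by
      rw [hr, hR₁, polySymbol_zero, zero_add]
  · rw [if_neg hR₁, ← negMultiplicity_leadingCoeff]
    have hjet : ∀ i : Option (Fin n),
        IsJet (i.elim 0 fun m => (γ m)⁻¹) (i.elim R₁.natDegree K)
          (i.elim R₁.leadingCoeff fun m => poleCoeff (γ m) (K m) (R m))
          (circleFunctional (i.elim (polySymbol R₁) fun m => poleSymbol (hγ m) (K m) (R m))) :=
      Option.rec (isJet_circleFunctional_polySymbol hR₁) hpole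
    have := hG.rank_negEigenspace_of_isJet hG_sa
      (Option.injective_iff.2 ⟨hβ, fun ⟨m, hm⟩ => inv_ne_zero (hγ_ne m) hm⟩) hjet fun t => by
        rw [hr, Fintype.sum_option]
        rfl
    simpa only [Fintype.sum_option, Option.elim] using this
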